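/- Let $n\ge 1$. Consider the vertex superalgebra of local operators generated by symplectic bosons $(X_i,Y_i)$ and fermi multiplets $(\psi_i,\chi_i)$, $1\le i\le n$, and $bc$-ghosts $(b_a,c^a)$, $1\le a\le n-1$, acting on their common Fock space, where $X,Y$ are even, $\psi,\chi,b,c$ are odd, and the only singular operator products between generators are $$X_i(z)Y_j(0)\sim\frac{\delta_{ij}}{z},\qquad \psi_i(z)\chi_j(0)\sim\frac{\delta_{ij}}{z},\qquad b_a(z)c^b(0)\sim\frac{\delta_a^b}{z}$$ (and those obtained from these by exchanging the two factors). For operators $A,B$ and $p\in\mathbb Z$ put $(AB)_p(w)=\oint\frac{dz}{2\pi i}(z-w)^{p-1}A(z)B(w)$ (radially ordered); $AB$ stands for the normally ordered product $(AB)_0$, $ABC$ for $(A(BC)_0)_0$, and $[A,B]=(AB)_0-(BA)_0$. Let $$J_{BRST}=\sum_{a=1}^{n-1}c^a\left(X_aY_a-X_{a+1}Y_{a+1}+\psi_a\chi_a-\psi_{a+1}\chi_{a+1}\right),\qquad Q=\oint\frac{dz}{2\pi i}J_{BRST}(z),$$ let $Q$ act on operators by $Q\mathcal O=(J_{BRST}\,\mathcal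 O)_1$, and write $A\equiv B$ if $A-B=Q\mathcal O$ for some operator $\mathcal O$ of the algebra. Put $\mathcal A_i=-X_iY_i$, $\hat{\mathcal A}_i\mathcal O=(\mathcal A_i\mathcal O)_0$, $\mathcal D_i\mathcal O=(\mathcal A_i\mathcal O)_0+(X_i(Y_i\mathcal O)_0)_0$, $D_i=\mathcal D_i+\hat{\mathcal A}_i$, $T_i=\tfrac12 D_i\mathcal A_i$, and $$U=-\frac1n\sum_{i=1}^nX_iY_i,\qquad U_F=-\frac1n\sum_{i=1}^n\psi_i\chi_i,\qquad M_i^+=X_i\psi_i,\qquad M_i^-=Y_i\chi_i .$$ Then for every $i\in\{1,\dots,n\}$ $$T_i\equiv\tfrac12\,(U+U_F)^2-\tfrac12\,[M_i^+,M_i^-].$$ -/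

import Mathlib

open scoped TensorProduct VertexOperator

noncomputable section

namespace FreeFieldVOA

/-! ### Fields and their products

A field `A(z) = ∑ₘ A₍ₘ₎ z^(-m-1)` on a complex vector space `V` is a `VertexOperator ℂ V`;
the mode `A₍ₘ₎` is `A[[m]]`. -/

section Fields

variable {V : Type*} [AddCommGroup V] [Module ℂ V]

theorem exists_modes_eq_zero (A : VertexOperator ℂ V) (v : V) :
    ∃ N : ℤ, ∀ m, N ≤ m → (A[[m]]) v = 0 := by
  refine ⟨-((HahnModule.of ℂ).symm (A v)).order, fun m hm => ?_⟩
  apply VertexOperator.ncoeff_eq_zero_of_lt_order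
  omega

/-- The field with prescribed modes. -/
def ofModes (f : ℤ → Module.End ℂ V) (hf : ∀ v, ∃ N : ℤ, ∀ m, N ≤ m → f m v = 0) :
    VertexOperator ℂ V :=
  VertexOperator.of_coeff (fun k => f (-k - 1)) fun v => by
    obtain ⟨N, hN⟩ := hf v
    refine ⟨-N, fun k hk => ?_⟩
    by_contra h
    exact hk (hN _ (by omega))

@[simp]
theorem ncoeff_ofModes (f : ℤ → Module.End ℂ V)
    (hf : ∀ v, ∃ N : ℤ, ∀ m, N ≤ m → f m v = 0) (m : ℤ) : (ofModes f hf)[[m]] = f m := by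
  rw [ofModes, VertexOperator.ncoeff_of_coeff]
  congr 1
  ring

/-- The identity field. -/
def idField (V : Type*) [AddCommGroup V] [Module ℂ V] : VertexOperator ℂ V :=
  ofModes (fun m => if m = -1 then 1 else 0) fun v => ⟨0, fun m hm => by
    have h : m ≠ -1 := by omega
    simp [h]⟩

/-- The even part of an endomorphism of a superspace with parity involution `Γ`. -/
def evenPart (Γ a : Module.End ℂ V) : Module.End ℂ V := (1 / 2 : ℂ) • (a + Γ * a * Γ)

/-- The odd part of an endomorphism of a superspace with parity involution `Γ`. -/
def oddPart (Γ a : Module.End ℂ V) : Module.End ℂ V := (1 / 2 : ℂ) • (a - Γ * a * Γ)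

/-- The bilinear extension of `(-1)^(|a||b|) b a`. -/
def swapMul (Γ a b : Module.End ℂ V) : Module.End ℂ V :=
  b * evenPart Γ a + Γ * b * Γ * oddPart Γ a

/-- The `j`-th term of the `m`-th mode of `∮ dz/(2πi) (z - w)^r A(z) B(w)`. -/
def prodTerm (Γ : Module.End ℂ V) (r : ℤ) (A B : VertexOperator ℂ V) (m : ℤ) (j : ℕ) :
    Module.End ℂ V :=
  ((-1 : ℂ) ^ j * ((Ring.choose r j : ℤ) : ℂ)) •
    (A[[r - j]] * B[[m + j]] - (-1 : ℂ) ^ r • swapMul Γ (A[[(j : ℤ)]]) (B[[r + m - j]]))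

theorem swapMul_eq_zero (Γ a b : Module.End ℂ V) (v : V) (h : a v = 0) (h' : a (Γ v) = 0) :
    swapMul Γ a b v = 0 := by
  simp [swapMul, evenPart, oddPart, h, h']

theorem exists_prodTerm_eq_zero (Γ : Module.End ℂ V) (r : ℤ) (A B : VertexOperator ℂ V)
    (m : ℤ) (v : V) : ∃ J : ℕ, ∀ j, J ≤ j → prodTerm Γ r A B m j v = 0 := by
  obtain ⟨N₁, h₁⟩ := exists_modes_eq_zero A v
  obtain ⟨N₂, h₂⟩ := exists_modes_eq_zero A (Γ v)
  obtain ⟨N₃, h₃⟩ := exists_modes_eq_zero B v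
  refine ⟨N₁.toNat + N₂.toNat + (N₃ - m).toNat, fun j hj => ?_⟩
  have e₁ := h₁ j (by omega)
  have e₂ := h₂ j (by omega)
  have e₃ := h₃ (m + j) (by omega)
  simp [prodTerm, e₃, swapMul_eq_zero Γ _ _ v e₁ e₂]

theorem finite_support_prodTerm (Γ : Module.End ℂ V) (r : ℤ) (A B : VertexOperator ℂ V)
    (m : ℤ) (v : V) : (Function.support fun j => prodTerm Γ r A B m j v).Finite := by
  obtain ⟨J, hJ⟩ := exists_prodTerm_eq_zero Γ r A B m v
  refine (Set.finite_lt_nat J).subset fun j hj => ?_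
  by_contra h
  exact hj (hJ j (by simpa using h))

/-- The `m`-th mode of `∮ dz/(2πi) (z - w)^r A(z) B(w)`; on every vector the sum is finite. -/
def prodMode (Γ : Module.End ℂ V) (r : ℤ) (A B : VertexOperator ℂ V) (m : ℤ) :
    Module.End ℂ V where
  toFun v := ∑ᶠ j : ℕ, prodTerm Γ r A B m j v
  map_add' v w := by
    simp only [map_add]
    exact finsum_add_distrib (finite_support_prodTerm Γ r A B m v)
      (finite_support_prodTerm Γ r A B m w)
  map_smul' c v := by
    simp only [map_smul, RingHom.id_apply]
    exact (smul_finsum' c (finite_support_prodTerm Γ r A B m v)).symm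

theorem exists_prodMode_eq_zero (Γ : Module.End ℂ V) (r : ℤ) (A B : VertexOperator ℂ V)
    (v : V) : ∃ N : ℤ, ∀ m, N ≤ m → prodMode Γ r A B m v = 0 := by
  obtain ⟨N₁, h₁⟩ := exists_modes_eq_zero A v
  obtain ⟨N₂, h₂⟩ := exists_modes_eq_zero A (Γ v)
  obtain ⟨N₃, h₃⟩ := exists_modes_eq_zero B v
  choose K hK using fun u : V => exists_modes_eq_zero B u
  let J : ℕ := N₁.toNat + N₂.toNat
  let u₁ : ℕ → V := fun j => evenPart Γ (A[[(j : ℤ)]]) v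
  let u₂ : ℕ → V := fun j => Γ (oddPart Γ (A[[(j : ℤ)]]) v)
  let S : ℕ := ∑ j ∈ Finset.range J, ((K (u₁ j)).toNat + (K (u₂ j)).toNat)
  refine ⟨(N₃.toNat + S + J + r.natAbs : ℕ), fun m hm => ?_⟩
  change ∑ᶠ j : ℕ, prodTerm Γ r A B m j v = 0
  refine finsum_eq_zero_of_forall_eq_zero fun j => ?_
  have e₃ : (B[[m + j]]) v = 0 := h₃ _ (by omega)
  have e : swapMul Γ (A[[(j : ℤ)]]) (B[[r + m - j]]) v = 0 := by
    by_cases hj : J ≤ j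
    · exact swapMul_eq_zero Γ _ _ v (h₁ _ (by omega)) (h₂ _ (by omega))
    · have hle : (K (u₁ j)).toNat + (K (u₂ j)).toNat ≤ S :=
        Finset.single_le_sum (f := fun j => (K (u₁ j)).toNat + (K (u₂ j)).toNat)
          (fun _ _ => Nat.zero_le _) (Finset.mem_range.2 (not_le.1 hj))
      have f₁ : (B[[r + m - j]]) (u₁ j) = 0 := hK _ _ (by omega)
      have f₂ : (B[[r + m - j]]) (u₂ j) = 0 := hK _ _ (by omega)
      simp only [u₁, u₂] at f₁ f₂
      simp [swapMul, f₁, f₂]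
  simp [prodTerm, e₃, e]

/-- The product `(A B)_p (w) = ∮ dz/(2πi) (z - w)^(p-1) A(z) B(w)` of two fields (radially
ordered), for `p : ℤ`. With `r = p - 1`, it is the residue at `z = 0` of the expansion of
`(z - w)^r A(z) B(w)` in `|z| > |w|` minus that of `(-1)^(|A||B|) (z - w)^r B(w) A(z)` in
`|w| > |z|`. -/
def opProd (Γ : Module.End ℂ V) (p : ℤ) (A B : VertexOperator ℂ V) : VertexOperator ℂ V :=
  ofModes (prodMode Γ (p - 1) A B) (exists_prodMode_eq_zero Γ (p - 1) A B)

/-- The space of operators generated by a set `G` of fields: the smallest linear space of fields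
that contains `G` and the identity field and is closed under all products `(A B)_p`. -/
def operatorSpace (Γ : Module.End ℂ V) (G : Set (VertexOperator ℂ V)) :
    Submodule ℂ (VertexOperator ℂ V) :=
  sInf {S | idField V ∈ S ∧ G ⊆ S ∧ ∀ (p : ℤ), ∀ A ∈ S, ∀ B ∈ S, opProd Γ p A B ∈ S}

end Fields

/-! ### The Fock space of symplectic bosons, fermi multiplets and `bc`-ghosts -/

/-- Labels of the symplectic bosons `Xᵢ, Yᵢ`. -/
inductive Boson (n : ℕ) : Type
  | X (i : Fin n)
  | Y (i : Fin n)

/-- Labels of the fermi multiplets `ψᵢ, χᵢ` and of the ghosts `bₐ, cᵃ`. -/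
inductive Fermion (n : ℕ) : Type
  | psi (i : Fin n)
  | chi (i : Fin n)
  | b (a : Fin (n - 1))
  | c (a : Fin (n - 1))

/-- The fermionic field whose singular operator product with the given one is `1 / z`. -/
def Fermion.dual {n : ℕ} : Fermion n → Fermion n
  | .psi i => .chi i
  | .chi i => .psi i
  | .b a => .c a
  | .c a => .b a

/-- Polynomials in the creation modes `φ₍₋ₘ₋₁₎`, `m : ℕ`, of the bosons `φ`. -/
abbrev BosonFock (n : ℕ) : Type := MvPolynomial (Boson n × ℕ) ℂ

/-- The exterior algebra on the creation modes `φ₍₋ₘ₋₁₎`, `m : ℕ`, of the fermions `φ`. -/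
abbrev FermionFock (n : ℕ) : Type := ExteriorAlgebra ℂ (Fermion n × ℕ →₀ ℂ)

/-- The Fock space. -/
abbrev Fock (n : ℕ) : Type := BosonFock n ⊗[ℂ] FermionFock n

/-- The parity involution of the Fock space (the bosonic factor is even). -/
def parity (n : ℕ) : Module.End ℂ (Fock n) :=
  LinearMap.lTensor (BosonFock n)
    (CliffordAlgebra.involute (Q := (0 : QuadraticForm ℂ (Fermion n × ℕ →₀ ℂ)))).toLinearMap

/-- The modes of the symplectic bosons, with `[X₍ₘ₎, Y₍ₖ₎] = 1` if `m + k = -1`. -/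
def bosonMode {n : ℕ} : Boson n → ℤ → Module.End ℂ (BosonFock n)
  | φ, Int.negSucc m => LinearMap.mulLeft ℂ (MvPolynomial.X (φ, m))
  | .X i, Int.ofNat m => (MvPolynomial.pderiv (Boson.Y i, m)).toLinearMap
  | .Y i, Int.ofNat m => -(MvPolynomial.pderiv (Boson.X i, m)).toLinearMap

/-- The modes of the fermions, with `{φ₍ₘ₎, (dual φ)₍ₖ₎} = 1` if `m + k = -1`. -/
def fermionMode {n : ℕ} (φ : Fermion n) : ℤ → Module.End ℂ (FermionFock n)
  | Int.negSucc m => LinearMap.mulLeft ℂ (ExteriorAlgebra.ι ℂ (Finsupp.single (φ, m) 1))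
  | Int.ofNat m => CliffordAlgebra.contractLeft
      (Q := (0 : QuadraticForm ℂ (Fermion n × ℕ →₀ ℂ))) (Finsupp.lapply (φ.dual, m))

theorem exists_pderiv_eq_zero {n : ℕ} (φ : Boson n) (p : BosonFock n) :
    ∃ N : ℕ, ∀ m, N ≤ m → MvPolynomial.pderiv (φ, m) p = 0 := by
  classical
  refine ⟨p.vars.sup (fun x => x.2) + 1, fun m hm => ?_⟩
  apply MvPolynomial.pderiv_eq_zero_of_notMem_vars
  intro h
  have := Finset.le_sup (f := fun x : Boson n × ℕ => x.2) h
  simp only at this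
  omega

theorem exists_bosonMode_eq_zero {n : ℕ} (φ : Boson n) (p : BosonFock n) :
    ∃ N : ℤ, ∀ m, N ≤ m → bosonMode φ m p = 0 := by
  cases φ with
  | X i =>
    obtain ⟨N, hN⟩ := exists_pderiv_eq_zero (Boson.Y i) p
    refine ⟨N, fun m hm => ?_⟩
    lift m to ℕ using by omega
    simpa [bosonMode] using hN m (by omega)
  | Y i =>
    obtain ⟨N, hN⟩ := exists_pderiv_eq_zero (Boson.X i) p
    refine ⟨N, fun m hm => ?_⟩
    lift m to ℕ using by omega
    simpa [bosonMode] using hN m (by omega)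

theorem exists_contract_eq_zero {n : ℕ} (φ : Fermion n) (x : FermionFock n) :
    ∃ N : ℕ, ∀ m, N ≤ m → CliffordAlgebra.contractLeft
      (Q := (0 : QuadraticForm ℂ (Fermion n × ℕ →₀ ℂ))) (Finsupp.lapply (φ, m)) x = 0 := by
  induction x using CliffordAlgebra.left_induction with
  | algebraMap r => exact ⟨0, fun m _ => by simp⟩
  | add x y hx hy =>
    obtain ⟨N, hN⟩ := hx
    obtain ⟨M, hM⟩ := hy
    exact ⟨N + M, fun m hm => by rw [map_add, hN m (by omega), hM m (by omega), add_zero]⟩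
  | ι_mul x u hx =>
    classical
    obtain ⟨N, hN⟩ := hx
    refine ⟨N + u.support.sup (fun y => y.2) + 1, fun m hm => ?_⟩
    have hu : u (φ, m) = 0 := by
      by_contra h
      have := Finset.le_sup (f := fun y : Fermion n × ℕ => y.2) (Finsupp.mem_support_iff.2 h)
      simp only at this
      omega
    rw [CliffordAlgebra.contractLeft_ι_mul, hN m (by omega)]
    simp [hu]

theorem exists_fermionMode_eq_zero {n : ℕ} (φ : Fermion n) (x : FermionFock n) :
    ∃ N : ℤ, ∀ m, N ≤ m → fermionMode φ m x = 0 := by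
  obtain ⟨N, hN⟩ := exists_contract_eq_zero φ.dual x
  refine ⟨N, fun m hm => ?_⟩
  lift m to ℕ using by omega
  exact hN m (by omega)

/-- The field `Xᵢ(z)` or `Yᵢ(z)` on the Fock space. -/
def bosonField {n : ℕ} (φ : Boson n) : VertexOperator ℂ (Fock n) :=
  ofModes (fun m => LinearMap.rTensor (FermionFock n) (bosonMode φ m)) fun v => by
    induction v using TensorProduct.induction_on with
    | zero => exact ⟨0, fun m _ => map_zero _⟩
    | tmul p x =>
      obtain ⟨N, hN⟩ := exists_bosonMode_eq_zero φ p
      exact ⟨N, fun m hm => by rw [LinearMap.rTensor_tmul, hN m hm, TensorProduct.zero_tmul]⟩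
    | add v w hv hw =>
      obtain ⟨N, hN⟩ := hv
      obtain ⟨M, hM⟩ := hw
      exact ⟨max N M, fun m hm => by
        rw [map_add, hN m (by omega), hM m (by omega), add_zero]⟩

/-- The field `ψᵢ(z)`, `χᵢ(z)`, `bₐ(z)` or `cᵃ(z)` on the Fock space. -/
def fermionField {n : ℕ} (φ : Fermion n) : VertexOperator ℂ (Fock n) :=
  ofModes (fun m => LinearMap.lTensor (BosonFock n) (fermionMode φ m)) fun v => by
    induction v using TensorProduct.induction_on with
    | zero => exact ⟨0, fun m _ => map_zero _⟩
    | tmul p x =>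
      obtain ⟨N, hN⟩ := exists_fermionMode_eq_zero φ x
      exact ⟨N, fun m hm => by rw [LinearMap.lTensor_tmul, hN m hm, TensorProduct.tmul_zero]⟩
    | add v w hv hw =>
      obtain ⟨N, hN⟩ := hv
      obtain ⟨M, hM⟩ := hw
      exact ⟨max N M, fun m hm => by
        rw [map_add, hN m (by omega), hM m (by omega), add_zero]⟩

/-! ### The BRST charge and the operators of the theory -/

/-- The symplectic boson `Xᵢ`. -/
def X {n : ℕ} (i : Fin n) : VertexOperator ℂ (Fock n) := bosonField (.X i)

/-- The symplectic boson `Yᵢ`. -/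
def Y {n : ℕ} (i : Fin n) : VertexOperator ℂ (Fock n) := bosonField (.Y i)

/-- The fermi field `ψᵢ`. -/
def psi {n : ℕ} (i : Fin n) : VertexOperator ℂ (Fock n) := fermionField (.psi i)

/-- The fermi field `χᵢ`. -/
def chi {n : ℕ} (i : Fin n) : VertexOperator ℂ (Fock n) := fermionField (.chi i)

/-- The ghost `bₐ`. -/
def ghostB {n : ℕ} (a : Fin (n - 1)) : VertexOperator ℂ (Fock n) := fermionField (.b a)

/-- The ghost `cᵃ`. -/
def ghostC {n : ℕ} (a : Fin (n - 1)) : VertexOperator ℂ (Fock n) := fermionField (.c a)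

/-- The normally ordered product `(A B)₀`. -/
def nop {n : ℕ} (A B : VertexOperator ℂ (Fock n)) : VertexOperator ℂ (Fock n) :=
  opProd (parity n) 0 A B

/-- All operators: the fields generated by `Xᵢ, Yᵢ, ψᵢ, χᵢ, bₐ, cᵃ`. -/
def operators (n : ℕ) : Submodule ℂ (VertexOperator ℂ (Fock n)) :=
  operatorSpace (parity n) (Set.range bosonField ∪ Set.range fermionField)

/-- The current `Xᵢ Yᵢ + ψᵢ χᵢ`. -/
def current {n : ℕ} (i : Fin n) : VertexOperator ℂ (Fock n) :=
  nop (X i) (Y i) + nop (psi i) (chi i)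

/-- The BRST current `∑ₐ cᵃ (Xₐ Yₐ - Xₐ₊₁ Yₐ₊₁ + ψₐ χₐ - ψₐ₊₁ χₐ₊₁)`, `a = 1, …, n - 1`. -/
def brstCurrent (n : ℕ) : VertexOperator ℂ (Fock n) :=
  ∑ a : Fin (n - 1), nop (ghostC a)
    (current ⟨a, by omega⟩ - current ⟨a + 1, by omega⟩)

/-- The action `∮ dz/(2πi) J_BRST(z) A(w)` of the BRST charge on an operator `A`, that is the
supercommutator of the zero mode of the BRST current with `A`. -/
def brst {n : ℕ} (A : VertexOperator ℂ (Fock n)) : VertexOperator ℂ (Fock n) :=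
  opProd (parity n) 1 (brstCurrent n) A

/-- `A ≡ B`: the difference `A - B` is `Q`-exact. -/
def BRSTEquiv {n : ℕ} (A B : VertexOperator ℂ (Fock n)) : Prop :=
  ∃ C ∈ operators n, A - B = brst C

/-- `𝒜ᵢ = - Xᵢ Yᵢ`. -/
def gaugeA {n : ℕ} (i : Fin n) : VertexOperator ℂ (Fock n) := -nop (X i) (Y i)

/-- `Âᵢ O = (𝒜ᵢ O)₀`. -/
def hatA {n : ℕ} (i : Fin n) (O : VertexOperator ℂ (Fock n)) : VertexOperator ℂ (Fock n) :=
  nop (gaugeA i) O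

/-- `𝒟ᵢ O = (𝒜ᵢ O)₀ + (Xᵢ (Yᵢ O)₀)₀`. -/
def partialD {n : ℕ} (i : Fin n) (O : VertexOperator ℂ (Fock n)) : VertexOperator ℂ (Fock n) :=
  nop (gaugeA i) O + nop (X i) (nop (Y i) O)

/-- The covariant derivative `Dᵢ = 𝒟ᵢ + Âᵢ`. -/
def covD {n : ℕ} (i : Fin n) (O : VertexOperator ℂ (Fock n)) : VertexOperator ℂ (Fock n) :=
  partialD i O + hatA i O

/-- `Tᵢ = ½ Dᵢ 𝒜ᵢ`. -/
def T {n : ℕ} (i : Fin n) : VertexOperator ℂ (Fock n) := (1 / 2 : ℂ) • covD i (gaugeA i)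

/-- `U = - (1/n) ∑ᵢ Xᵢ Yᵢ`. -/
def U (n : ℕ) : VertexOperator ℂ (Fock n) := -(1 / n : ℂ) • ∑ i : Fin n, nop (X i) (Y i)

/-- `U_F = - (1/n) ∑ᵢ ψᵢ χᵢ`. -/
def UF (n : ℕ) : VertexOperator ℂ (Fock n) := -(1 / n : ℂ) • ∑ i : Fin n, nop (psi i) (chi i)

/-- `Mᵢ⁺ = Xᵢ ψᵢ`. -/
def Mplus {n : ℕ} (i : Fin n) : VertexOperator ℂ (Fock n) := nop (X i) (psi i)

/-- `Mᵢ⁻ = Yᵢ χᵢ`. -/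
def Mminus {n : ℕ} (i : Fin n) : VertexOperator ℂ (Fock n) := nop (Y i) (chi i)

end FreeFieldVOA

end

/-!
The currents `Jᵢ = Xᵢ Yᵢ + ψᵢ χᵢ` have regular operator products with one another, because the
levels of their bosonic and fermionic summands are opposite. By Wick's theorem the BRST operator
therefore sends `b_a J_k` to `(J_a - J_{a+1}) J_k`, so that all the products `J_j J_k` are
cohomologous and `(U + U_F)²`, which is their average, is cohomologous to `Jᵢ Jᵢ`.

On the other hand `Tᵢ = ½ Jᵢ Jᵢ - ½ [Mᵢ⁺, Mᵢ⁻]` holds exactly. Products of the generators can be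
rebracketed because `(A B) C` and `A (B C)` differ by the normally ordered products of `∂A` with the
contraction of `B` and `C` and of `∂B` with the contraction of `A` and `C`; the quartic terms of the
two sides agree, and so do the derivative terms.
-/

noncomputable section

namespace FreeFieldVOA

/-! ### Pointwise finite sums of endomorphisms -/

section PointwiseSums

variable {R M ι κ : Type*} [CommRing R] [AddCommGroup M] [Module R M]
  {f g : ι → Module.End R M} {a b : Module.End R M}

/-- `∑ᵢ fᵢ = a` where on every vector only finitely many `fᵢ` are nonzero: the sense in which the
infinite sums of products of modes converge. -/
def HasPointwiseSum (f : ι → Module.End R M) (a : Module.End R M) : Prop :=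
  ∀ v, (Function.support fun i => f i v).Finite ∧ ∑ᶠ i, f i v = a v

namespace HasPointwiseSum

theorem unique (ha : HasPointwiseSum f a) (hb : HasPointwiseSum f b) : a = b :=
  LinearMap.ext fun v => (ha v).2.symm.trans (hb v).2

theorem zero : HasPointwiseSum (fun _ : ι => (0 : Module.End R M)) 0 := fun v => by
  simp [Function.support_fun_zero]

theorem add (hf : HasPointwiseSum f a) (hg : HasPointwiseSum g b) :
    HasPointwiseSum (fun i => f i + g i) (a + b) := fun v =>
  ⟨((hf v).1.union (hg v).1).subset (Function.support_add _ _),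
    (finsum_add_distrib (hf v).1 (hg v).1).trans (congrArg₂ (· + ·) (hf v).2 (hg v).2)⟩

theorem mul_left (c : Module.End R M) (hf : HasPointwiseSum f a) :
    HasPointwiseSum (fun i => c * f i) (c * a) := fun v =>
  ⟨(hf v).1.subset (Function.support_comp_subset (map_zero c) _), by
    rw [Module.End.mul_apply, ← (hf v).2]
    exact (AddMonoidHom.map_finsum c.toAddMonoidHom (hf v).1).symm⟩

theorem mul_right (c : Module.End R M) (hf : HasPointwiseSum f a) :
    HasPointwiseSum (fun i => f i * c) (a * c) := fun v => hf (c v)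

theorem const_smul (r : R) (hf : HasPointwiseSum f a) :
    HasPointwiseSum (fun i => r • f i) (r • a) := by
  simpa only [smul_one_mul] using hf.mul_left (r • 1)

theorem comp_equiv (e : κ ≃ ι) (hf : HasPointwiseSum f a) :
    HasPointwiseSum (fun k => f (e k)) a := fun v =>
  ⟨(hf v).1.preimage e.injective.injOn,
    (finsum_comp_equiv e (f := fun i => f i v)).trans (hf v).2⟩

theorem of_fiberwise {F : ι × κ → Module.End R M}
    (hF : ∀ i, HasPointwiseSum (fun k => F (i, k)) (f i))
    (hf : HasPointwiseSum f a) (hfin : ∀ v, {i | ∃ k, F (i, k) v ≠ 0}.Finite) :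
    HasPointwiseSum F a := fun v => by
  have hsupp : (Function.support fun x => F x v).Finite :=
    ((hfin v).biUnion fun i _ => ((hF i v).1.image (Prod.mk i))).subset fun x hx =>
      Set.mem_biUnion (⟨x.2, hx⟩ : x.1 ∈ {i | ∃ k, F (i, k) v ≠ 0}) ⟨x.2, hx, rfl⟩
  refine ⟨hsupp, ?_⟩
  rw [finsum_curry _ hsupp, ← (hf v).2]
  exact finsum_congr fun i => (hF i v).2

theorem single [DecidableEq ι] (i : ι) (a : Module.End R M) :
    HasPointwiseSum (fun j => if j = i then a else 0) a := fun v => by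
  have hne (j : ι) (hj : j ≠ i) : (if j = i then a else 0) v = 0 := by
    rw [if_neg hj, LinearMap.zero_apply]
  refine ⟨(Set.finite_singleton i).subset fun j hj => not_not.1 fun h => hj (hne j h), ?_⟩
  rw [finsum_eq_single _ i hne, if_pos rfl]

theorem of_nat_add_negSucc {f : ℤ → Module.End R M}
    (hf : ∀ v, (Function.support fun p => f p v).Finite)
    (h : HasPointwiseSum (fun j : ℕ => f j + f (Int.negSucc j)) a) : HasPointwiseSum f a := by
  intro v
  have hcompl : (Set.range Int.negSucc) = (Set.range ((↑) : ℕ → ℤ))ᶜ := by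
    ext p; cases p <;> simp
  have hnat : (Function.support fun j : ℕ => f j v).Finite :=
    (hf v).preimage Nat.cast_injective.injOn
  have hneg : (Function.support fun j : ℕ => f (Int.negSucc j) v).Finite :=
    (hf v).preimage fun _ _ _ _ => Int.negSucc.inj
  refine ⟨hf v, ?_⟩
  rw [← finsum_mem_univ, ← Set.union_compl_self (Set.range ((↑) : ℕ → ℤ)),
    finsum_mem_union' disjoint_compl_right ((hf v).inter_of_right _) ((hf v).inter_of_right _),
    ← hcompl, finsum_mem_range Nat.cast_injective, finsum_mem_range fun _ _ => Int.negSucc.inj,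
    ← finsum_add_distrib hnat hneg]
  exact (h v).2

end HasPointwiseSum

variable (R) in
/-- The indicator function of the negative integers, which decides the side of a mode in a normally
ordered product. -/
def negStep (p : ℤ) : R := if p < 0 then 1 else 0

theorem negStep_of_neg {p : ℤ} (hp : p < 0) : negStep R p = 1 := if_pos hp

theorem negStep_of_nonneg {p : ℤ} (hp : 0 ≤ p) : negStep R p = 0 := if_neg hp.not_gt

theorem negStep_sub_negStep_add_one (p : ℤ) :
    negStep R p - negStep R (p + 1) = if p = -1 then 1 else 0 := by
  simp only [negStep]
  split_ifs <;> first | omega | simp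

theorem hasPointwiseSum_negStep (k : ℤ) (a : Module.End R M) :
    HasPointwiseSum (fun p => (negStep R p - negStep R (p + k)) • a) ((k : R) • a) := by
  have hstep (k : ℤ) :
      HasPointwiseSum (fun p => (negStep R (p + k) - negStep R (p + (k + 1))) • a) a := by
    convert HasPointwiseSum.single (-k - 1) a using 2 with p
    rw [← add_assoc, negStep_sub_negStep_add_one, ite_smul, one_smul, zero_smul]
    exact if_congr (by omega) rfl rfl
  induction k with
  | zero => simpa using HasPointwiseSum.zero (M := M) (ι := ℤ)
  | succ k ih =>
    convert ih.add (hstep k) using 1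
    · ext1 p; module
    · push_cast; module
  | pred k ih =>
    convert ih.add ((hstep (-k - 1)).const_smul (-1)) using 1
    · ext1 p; rw [show -(k : ℤ) - 1 + 1 = -k by ring]; module
    · push_cast; module

end PointwiseSums

/-! ### Normal ordering of modes -/

section NormalOrd

variable {R M ι : Type*} [CommRing R] [AddCommGroup M] [Module R M]
  {a b k l x : Module.End R M} {f : ι → Module.End R M} {s t : R} {p : ℤ}

/-- The normal ordering of `a` and `b`, where `a` is the `p`-th mode of a field and `s` is the sign
with which `a` and `b` are exchanged: the modes with `p < 0` create, the others annihilate. -/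
def normalOrd (s : R) (p : ℤ) (a b : Module.End R M) : Module.End R M :=
  if p < 0 then a * b else s • (b * a)

theorem normalOrd_of_neg (hp : p < 0) : normalOrd s p a b = a * b := if_pos hp

theorem normalOrd_of_nonneg (hp : 0 ≤ p) : normalOrd s p a b = s • (b * a) := if_neg hp.not_gt

theorem normalOrd_eq_sub_smul :
    normalOrd s p a b = a * b - (1 - negStep R p) • (a * b - s • (b * a)) := by
  rcases lt_or_ge p 0 with hp | hp
  · rw [normalOrd_of_neg hp, negStep_of_neg hp]; module
  · rw [normalOrd_of_nonneg hp, negStep_of_nonneg hp]; module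

theorem HasPointwiseSum.normalOrd_left (hf : HasPointwiseSum f a) (s : R) (p : ℤ)
    (b : Module.End R M) :
    HasPointwiseSum (fun i => normalOrd s p (f i) b) (normalOrd s p a b) := by
  rcases lt_or_ge p 0 with hp | hp
  · simpa only [normalOrd_of_neg hp] using hf.mul_right b
  · simpa only [normalOrd_of_nonneg hp] using (hf.mul_left b).const_smul s

theorem HasPointwiseSum.normalOrd_right (hf : HasPointwiseSum f b) (s : R) (p : ℤ)
    (a : Module.End R M) :
    HasPointwiseSum (fun i => normalOrd s p a (f i)) (normalOrd s p a b) := by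
  rcases lt_or_ge p 0 with hp | hp
  · simpa only [normalOrd_of_neg hp] using hf.mul_left a
  · simpa only [normalOrd_of_nonneg hp] using (hf.mul_right a).const_smul s

theorem mul_normalOrd (ha : x * a = s • (a * x) + k) (hb : x * b = t • (b * x) + l)
    (hs : s * s = 1) (r : R) (p : ℤ) :
    x * normalOrd r p a b = (s * t) • (normalOrd r p a b * x) + normalOrd (r * t) p k b
      + s • normalOrd (r * s) p a l := by
  rcases lt_or_ge p 0 with hp | hp
  · simp only [normalOrd_of_neg hp]
    rw [← mul_assoc, ha, add_mul, smul_mul_assoc, mul_assoc a x b, hb]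
    simp only [mul_add, mul_smul_comm, smul_add, mul_assoc]
    module
  · simp only [normalOrd_of_nonneg hp]
    rw [mul_smul_comm, ← mul_assoc, hb, add_mul, smul_mul_assoc, mul_assoc b x a, ha]
    simp only [mul_add, smul_mul_assoc, mul_smul_comm, smul_add, mul_assoc]
    linear_combination (norm := module) (-r * hs) • (l * a)

theorem normalOrd_normalOrd {a b c a' b' : Module.End R M} {s t u : R} {p q n : ℤ}
    (hs : s * s = 1) (hac : a * c = t • (c * a) + a') (hbc : b * c = u • (c * b) + b')
    (hn : n = p + q + 1) :
    normalOrd (t * u) n (normalOrd s p a b) c =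
      normalOrd (s * t) p a (normalOrd u q b c)
        + (negStep R n - negStep R q) • normalOrd (s * t) p a b'
        + (negStep R n - negStep R p) • s • normalOrd (s * u) q b a' := by
  have ha' : a' = a * c - t • (c * a) := by rw [hac]; module
  have hb' : b' = b * c - u • (c * b) := by rw [hbc]; module
  rcases lt_or_ge p 0 with hp | hp <;> rcases lt_or_ge q 0 with hq | hq
  · simp only [negStep_of_neg, normalOrd_of_neg, hp, hq, (by omega : n < 0), mul_assoc]
    module
  · rcases lt_or_ge n 0 with h | h <;>
      simp only [negStep_of_neg, negStep_of_nonneg, normalOrd_of_neg, normalOrd_of_nonneg, hp, hq,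
        h, ha', hb', mul_sub, sub_mul, smul_mul_assoc, mul_smul_comm, smul_sub, mul_assoc]
    · module
    · linear_combination (norm := module) (u * hs) • (a * (c * b) - t • (c * (a * b)))
  · rcases lt_or_ge n 0 with h | h <;>
      simp only [negStep_of_neg, negStep_of_nonneg, normalOrd_of_neg, normalOrd_of_nonneg, hp, hq,
        h, ha', hb', mul_sub, sub_mul, smul_mul_assoc, mul_smul_comm, smul_sub, mul_assoc] <;>
      module
  · simp only [negStep_of_nonneg, normalOrd_of_nonneg, hp, hq, (by omega : 0 ≤ n), mul_assoc,
      smul_mul_assoc, mul_smul_comm]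
    module

/-- The endomorphisms `f i k` vanish on every vector for all `k` above a bound that does not depend
on `i`. -/
def UniformlyTruncated (f : ι → ℤ → Module.End R M) : Prop :=
  ∀ v, ∃ N : ℤ, ∀ k, N ≤ k → ∀ i, f i k v = 0

theorem UniformlyTruncated.finite_normalOrd {κ : Type*} {f : ι → ℤ → Module.End R M}
    {g : κ → ℤ → Module.End R M} (hf : UniformlyTruncated f) (hg : UniformlyTruncated g) (s : R)
    (k : ℤ) (v : M) : {p | ∃ i j, normalOrd s p (f i p) (g j (k - p)) v ≠ 0}.Finite := by
  obtain ⟨N, hN⟩ := hf v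
  obtain ⟨K, hK⟩ := hg v
  refine (Set.finite_Icc (min 0 (k - K)) (max 0 N)).subset fun p ⟨i, j, hne⟩ => ?_
  by_contra hp
  rw [Set.mem_Icc, not_and_or, not_le, not_le] at hp
  apply hne
  rcases lt_or_ge p 0 with h | h
  · rw [normalOrd_of_neg h, Module.End.mul_apply, hK _ (by omega), map_zero]
  · rw [normalOrd_of_nonneg h, LinearMap.smul_apply, Module.End.mul_apply, hN _ (by omega),
      map_zero, smul_zero]

end NormalOrd

section Modes

variable {V : Type*} [AddCommGroup V] [Module ℂ V]

theorem uniformlyTruncated_ncoeff (A : VertexOperator ℂ V) :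
    UniformlyTruncated fun (_ : Unit) k => A[[k]] := fun v =>
  (exists_modes_eq_zero A v).imp fun _ hN k hk _ => hN k hk

theorem uniformlyTruncated_normalOrd (s : ℂ) (A B : VertexOperator ℂ V) :
    UniformlyTruncated fun p k => normalOrd s p (A[[p]]) (B[[k - 1 - p]]) := fun v => by
  obtain ⟨N, hN⟩ := exists_modes_eq_zero A v
  obtain ⟨M, hM⟩ := exists_modes_eq_zero B v
  choose K hK using fun p : ℤ => exists_modes_eq_zero B ((A[[p]]) v)
  obtain ⟨L, hL⟩ := ((Finset.Ico 0 N).image fun p => K p + p + 1).exists_le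
  refine ⟨max M L, fun k hk p => ?_⟩
  beta_reduce
  rcases lt_or_ge p 0 with hp | hp
  · rw [normalOrd_of_neg hp, Module.End.mul_apply, hM _ (by omega), map_zero]
  · rw [normalOrd_of_nonneg hp, LinearMap.smul_apply, Module.End.mul_apply]
    rcases lt_or_ge p N with hpN | hpN
    · have := hL (K p + p + 1) (Finset.mem_image_of_mem _ (Finset.mem_Ico.2 ⟨hp, hpN⟩))
      rw [hK p _ (by omega), smul_zero]
    · rw [hN p hpN, map_zero, smul_zero]

end Modes

/-! ### Products of fields of definite parity -/

section Bilinearity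

variable {V : Type*} [AddCommGroup V] [Module ℂ V]

theorem field_ext {A B : VertexOperator ℂ V} (h : ∀ m, A[[m]] = B[[m]]) : A = B :=
  HVertexOperator.coeff_inj <| funext fun k => by
    simpa only [VertexOperator.coeff_eq_ncoeff] using h (-k - 1)

theorem hasPointwiseSum_opProd (Γ : Module.End ℂ V) (p : ℤ) (A B : VertexOperator ℂ V) (m : ℤ) :
    HasPointwiseSum (prodTerm Γ (p - 1) A B m) ((opProd Γ p A B)[[m]]) := fun v =>
  ⟨finite_support_prodTerm Γ _ A B m v, by rw [opProd, ncoeff_ofModes]; rfl⟩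

/-- The product `(A B)_p` as a bilinear map. -/
def opProdₗ (Γ : Module.End ℂ V) (p : ℤ) :
    VertexOperator ℂ V →ₗ[ℂ] VertexOperator ℂ V →ₗ[ℂ] VertexOperator ℂ V := by
  refine LinearMap.mk₂ ℂ (opProd Γ p) (fun A A' B => field_ext fun m => ?_)
    (fun c A B => field_ext fun m => ?_) (fun A B B' => field_ext fun m => ?_)
    (fun c A B => field_ext fun m => ?_) <;>
  refine (hasPointwiseSum_opProd Γ p _ _ m).unique ?_
  · rw [map_add, Pi.add_apply]
    convert (hasPointwiseSum_opProd Γ p A B m).add (hasPointwiseSum_opProd Γ p A' B m) using 2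
    simp only [prodTerm, swapMul, evenPart, oddPart, map_add, Pi.add_apply, mul_add, add_mul,
      mul_smul_comm, mul_sub]
    module
  · rw [map_smul, Pi.smul_apply]
    convert (hasPointwiseSum_opProd Γ p A B m).const_smul c using 2
    simp only [prodTerm, swapMul, evenPart, oddPart, map_smul, Pi.smul_apply, mul_add,
      mul_smul_comm, smul_mul_assoc, mul_sub]
    module
  · rw [map_add, Pi.add_apply]
    convert (hasPointwiseSum_opProd Γ p A B m).add (hasPointwiseSum_opProd Γ p A B' m) using 2
    simp only [prodTerm, swapMul, map_add, Pi.add_apply, mul_add, add_mul]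
    module
  · rw [map_smul, Pi.smul_apply]
    convert (hasPointwiseSum_opProd Γ p A B m).const_smul c using 2
    simp only [prodTerm, swapMul, map_smul, Pi.smul_apply, mul_smul_comm, smul_mul_assoc]
    module

end Bilinearity

section Parity

variable {V : Type*} [AddCommGroup V] [Module ℂ V] {Γ : Module.End ℂ V} {e f : ℕ}
  {A B : VertexOperator ℂ V}

/-- The field `A` on a superspace with parity involution `Γ` has parity `e`. -/
def HasParity (Γ : Module.End ℂ V) (e : ℕ) (A : VertexOperator ℂ V) : Prop :=
  ∀ m, Γ * A[[m]] = (-1 : ℂ) ^ e • (A[[m]] * Γ)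

theorem neg_one_pow_mul_self (e : ℕ) : (-1 : ℂ) ^ e * (-1) ^ e = 1 := by
  rw [← mul_pow, neg_one_mul, neg_neg, one_pow]

theorem swapMul_eq (hΓ : Γ * Γ = 1) {a b : Module.End ℂ V}
    (ha : Γ * a = (-1 : ℂ) ^ e • (a * Γ)) (hb : Γ * b = (-1 : ℂ) ^ f • (b * Γ)) :
    swapMul Γ a b = (-1 : ℂ) ^ (e * f) • (b * a) := by
  have ha' : Γ * a * Γ = (-1 : ℂ) ^ e • a := by rw [ha, smul_mul_assoc, mul_assoc, hΓ, mul_one]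
  have hb' : Γ * b * Γ = (-1 : ℂ) ^ f • b := by rw [hb, smul_mul_assoc, mul_assoc, hΓ, mul_one]
  rw [swapMul, evenPart, oddPart, ha', hb', pow_mul]
  rcases neg_one_pow_eq_or ℂ e with h | h <;> rw [h]
  · rw [one_pow, one_smul, one_smul, sub_self, smul_zero, mul_zero, ← two_smul ℂ a, smul_smul]
    norm_num
  · rw [neg_one_smul, add_neg_cancel, smul_zero, mul_zero, sub_neg_eq_add, ← two_smul ℂ a,
      smul_smul, smul_mul_assoc]
    norm_num

theorem choose_neg_one (j : ℕ) : Ring.choose (-1 : ℤ) j = (-1) ^ j := by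
  rw [Ring.choose_neg', Ring.multichoose_one, Int.negOnePow_def, zpow_natCast, Units.smul_def,
    smul_eq_mul, mul_one, Units.val_pow_eq_pow_val, Units.val_neg, Units.val_one]

theorem finite_normalOrd_ncoeff (s : ℂ) (A B : VertexOperator ℂ V) (k : ℤ) (v : V) :
    (Function.support fun p => normalOrd s p (A[[p]]) (B[[k - p]]) v).Finite :=
  ((uniformlyTruncated_ncoeff A).finite_normalOrd (uniformlyTruncated_ncoeff B) s k v).subset
    fun _ hp => ⟨(), (), hp⟩

theorem hasPointwiseSum_opProd_zero (hΓ : Γ * Γ = 1) (hA : HasParity Γ e A)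
    (hB : HasParity Γ f B) (m : ℤ) :
    HasPointwiseSum (fun p => normalOrd ((-1) ^ (e * f)) p (A[[p]]) (B[[m - 1 - p]]))
      ((opProd Γ 0 A B)[[m]]) := by
  refine .of_nat_add_negSucc (finite_normalOrd_ncoeff _ A B (m - 1)) fun v => ?_
  have hterm (j : ℕ) : normalOrd ((-1) ^ (e * f)) j (A[[(j : ℤ)]]) (B[[m - 1 - j]]) +
      normalOrd ((-1) ^ (e * f)) (Int.negSucc j) (A[[Int.negSucc j]]) (B[[m - 1 - Int.negSucc j]])
      = prodTerm Γ (0 - 1) A B m j := by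
    rw [normalOrd_of_nonneg (by omega), normalOrd_of_neg (Int.negSucc_lt_zero j), prodTerm,
      swapMul_eq hΓ (hA _) (hB _), zero_sub, choose_neg_one, Int.negSucc_eq,
      show m - 1 - -((j : ℤ) + 1) = m + j by ring, show (-1 : ℤ) - j = -(j + 1) by ring,
      show (-1 : ℤ) + m - j = m - 1 - j by ring]
    push_cast
    rw [neg_one_pow_mul_self, zpow_neg_one]
    norm_num
    abel
  simp only [hterm]
  exact hasPointwiseSum_opProd Γ 0 A B m v

theorem ncoeff_opProd_one (hΓ : Γ * Γ = 1) (hA : HasParity Γ e A) (hB : HasParity Γ f B)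
    (m : ℤ) :
    (opProd Γ 1 A B)[[m]] = A[[0]] * B[[m]] - (-1 : ℂ) ^ (e * f) • (B[[m]] * A[[0]]) := by
  refine (hasPointwiseSum_opProd Γ 1 A B m).unique ?_
  convert HasPointwiseSum.single 0 _ using 2 with j
  rcases eq_or_ne j 0 with rfl | hj
  · rw [if_pos rfl, prodTerm, swapMul_eq hΓ (hA _) (hB _)]
    simp
  · rw [if_neg hj, prodTerm, sub_self, Ring.choose_zero_pos _ (Nat.pos_of_ne_zero hj),
      Int.cast_zero, mul_zero, zero_smul]

namespace HasParity

theorem of_even_add (hA : HasParity Γ e A) (hef : Even (e + f)) : HasParity Γ f A := fun m => by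
  rw [hA m, neg_one_pow_congr (Nat.even_add.1 hef)]

theorem add (hA : HasParity Γ e A) (hB : HasParity Γ e B) : HasParity Γ e (A + B) := fun m => by
  rw [map_add]
  simp only [Pi.add_apply, mul_add, add_mul, hA m, hB m, smul_add]

theorem smul (hA : HasParity Γ e A) (c : ℂ) : HasParity Γ e (c • A) := fun m => by
  rw [map_smul]
  simp only [Pi.smul_apply, mul_smul_comm, smul_mul_assoc, hA m, smul_comm c]

theorem zero : HasParity Γ e (0 : VertexOperator ℂ V) := fun m => by simp

theorem sub (hA : HasParity Γ e A) (hB : HasParity Γ e B) : HasParity Γ e (A - B) := by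
  rw [sub_eq_add_neg, ← neg_one_smul ℂ B]
  exact hA.add (hB.smul _)

theorem sum {ι : Type*} {t : Finset ι} {A : ι → VertexOperator ℂ V}
    (hA : ∀ i ∈ t, HasParity Γ e (A i)) : HasParity Γ e (∑ i ∈ t, A i) := fun m => by
  rw [map_sum, Finset.sum_apply, Finset.mul_sum, Finset.sum_mul, Finset.smul_sum]
  exact Finset.sum_congr rfl fun i hi => hA i hi m

theorem idField : HasParity Γ 0 (idField V) := fun m => by
  rw [FreeFieldVOA.idField, ncoeff_ofModes]
  split_ifs <;> simp

theorem opProd_zero (hΓ : Γ * Γ = 1) (hA : HasParity Γ e A) (hB : HasParity Γ f B) :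
    HasParity Γ (e + f) (opProd Γ 0 A B) := fun m => by
  have hsum := hasPointwiseSum_opProd_zero hΓ hA hB m
  refine ((hsum.mul_left Γ).unique ?_)
  convert (hsum.mul_right Γ).const_smul ((-1) ^ (e + f)) using 2 with p
  have hmul := mul_normalOrd (k := 0) (l := 0) ((hA p).trans (add_zero _).symm)
    ((hB (m - 1 - p)).trans (add_zero _).symm) (neg_one_pow_mul_self e) ((-1) ^ (e * f)) p
  simpa [normalOrd, pow_add] using hmul

end HasParity
end Parity

/-! ### Operator product expansions and Wick's theorem -/

section OPE

variable {V : Type*} [AddCommGroup V] [Module ℂ V] {s : ℂ}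
  {A A' B B' C C' D D' F K L P : VertexOperator ℂ V}

/-- The operator product expansion `A(z) B(w) ∼ C(w) / (z - w) + D(w) / (z - w)²`, written as
commutation relations of the modes; `s` is the sign with which `A` and `B` are exchanged. -/
def HasOPE (s : ℂ) (A B C D : VertexOperator ℂ V) : Prop :=
  ∀ p q, A[[p]] * B[[q]] = s • (B[[q]] * A[[p]]) + C[[p + q]] + (p : ℂ) • D[[p + q - 1]]

namespace HasOPE

theorem mul_eq (h : HasOPE s A B C 0) (p q : ℤ) :
    A[[p]] * B[[q]] = s • (B[[q]] * A[[p]]) + C[[p + q]] := by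
  simpa using h p q

theorem add_left (h : HasOPE s A B C D) (h' : HasOPE s A' B C' D') :
    HasOPE s (A + A') B (C + C') (D + D') := fun p q => by
  simp only [map_add, Pi.add_apply, add_mul, mul_add, h p q, h' p q]
  module

theorem add_right (h : HasOPE s A B C D) (h' : HasOPE s A B' C' D') :
    HasOPE s A (B + B') (C + C') (D + D') := fun p q => by
  simp only [map_add, Pi.add_apply, add_mul, mul_add, h p q, h' p q]
  module

theorem smul_left (h : HasOPE s A B C D) (c : ℂ) : HasOPE s (c • A) B (c • C) (c • D) :=
  fun p q => by
    simp only [map_smul, Pi.smul_apply, smul_mul_assoc, mul_smul_comm, h p q]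
    module

theorem sub_left (h : HasOPE s A B C D) (h' : HasOPE s A' B C' D') :
    HasOPE s (A - A') B (C - C') (D - D') := fun p q => by
  simp only [map_sub, Pi.sub_apply, sub_mul, mul_sub, h p q, h' p q]
  module

theorem sum_left {ι : Type*} {t : Finset ι} {A C D : ι → VertexOperator ℂ V}
    (h : ∀ i ∈ t, HasOPE s (A i) B (C i) (D i)) :
    HasOPE s (∑ i ∈ t, A i) B (∑ i ∈ t, C i) (∑ i ∈ t, D i) := fun p q => by
  simp only [map_sum, Finset.sum_apply, Finset.sum_mul, Finset.mul_sum, Finset.smul_sum,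
    ← Finset.sum_add_distrib]
  exact Finset.sum_congr rfl fun i hi => h i hi p q

theorem symm (h : HasOPE s A B C 0) (hs : s * s = 1) : HasOPE s B A (-(s • C)) 0 := fun p q => by
  rw [h.mul_eq q p, add_comm q p]
  simp only [map_neg, map_smul, map_zero, Pi.neg_apply, Pi.smul_apply, Pi.zero_apply]
  linear_combination (norm := module) (-hs) • (B[[p]] * A[[q]])

theorem opProd_one {Γ : Module.End ℂ V} {a b : ℕ} (h : HasOPE ((-1) ^ (a * b)) A B C D)
    (hΓ : Γ * Γ = 1) (hA : HasParity Γ a A) (hB : HasParity Γ b B) : opProd Γ 1 A B = C :=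
  field_ext fun m => by
    rw [ncoeff_opProd_one hΓ hA hB, h 0 m]
    simp

/-- Wick's theorem: besides the two single contractions, the contraction `K` of `F` with `A` may
itself contract with `B`, which produces the double pole `P`. -/
theorem opProd_zero {Γ : Module.End ℂ V} {f a b : ℕ} (hFA : HasOPE ((-1) ^ (f * a)) F A K 0)
    (hFB : HasOPE ((-1) ^ (f * b)) F B L 0) (hKB : HasOPE ((-1) ^ ((f + a) * b)) K B P 0)
    (hΓ : Γ * Γ = 1) (hA : HasParity Γ a A) (hB : HasParity Γ b B)
    (hK : HasParity Γ (f + a) K) (hL : HasParity Γ (f + b) L) :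
    HasOPE ((-1) ^ (f * (a + b))) F (opProd Γ 0 A B)
      (opProd Γ 0 K B + (-1 : ℂ) ^ (f * a) • opProd Γ 0 A L) P := fun k m => by
  have hAB := hasPointwiseSum_opProd_zero hΓ hA hB m
  have hsumK := (hasPointwiseSum_opProd_zero hΓ hK hB (k + m)).comp_equiv (Equiv.addRight k)
  have hsumL := (hasPointwiseSum_opProd_zero hΓ hA hL (k + m)).const_smul ((-1) ^ (f * a))
  have hsumP := hasPointwiseSum_negStep k (P[[k + m - 1]])
  refine (hAB.mul_left (F[[k]])).unique ?_
  rw [map_add, map_smul, Pi.add_apply, Pi.smul_apply, ← add_assoc]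
  convert ((((hAB.mul_right (F[[k]])).const_smul ((-1) ^ (f * (a + b)))).add hsumK).add hsumL).add
    hsumP using 2 with p
  have hcut : normalOrd ((-1) ^ ((f + a) * b)) p (K[[k + p]]) (B[[m - 1 - p]]) =
      normalOrd ((-1) ^ ((f + a) * b)) (p + k) (K[[p + k]]) (B[[k + m - 1 - (p + k)]]) +
        (negStep ℂ p - negStep ℂ (p + k)) • P[[k + m - 1]] := by
    have hcomm := hKB.mul_eq (p + k) (m - 1 - p)
    rw [show p + k + (m - 1 - p) = k + m - 1 by ring] at hcomm
    rw [show k + m - 1 - (p + k) = m - 1 - p by ring, add_comm k p, normalOrd_eq_sub_smul (p := p),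
      normalOrd_eq_sub_smul (p := p + k), hcomm]
    module
  rw [mul_normalOrd (hFA.mul_eq k p) (hFB.mul_eq k (m - 1 - p)) (neg_one_pow_mul_self _)]
  have hsignK : (-1 : ℂ) ^ (a * b) * (-1) ^ (f * b) = (-1) ^ ((f + a) * b) := by ring
  have hsignL : (-1 : ℂ) ^ (a * b) * (-1) ^ (f * a) = (-1) ^ (a * (f + b)) := by ring
  have hsign : (-1 : ℂ) ^ (f * a) * (-1) ^ (f * b) = (-1) ^ (f * (a + b)) := by ring
  rw [hsignK, hsignL, hsign, hcut, show k + (m - 1 - p) = k + m - 1 - p by ring]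
  simp only [Equiv.coe_addRight]
  abel

end HasOPE
end OPE

/-! ### Associativity and commutativity of the normally ordered product -/

section QuasiAssociativity

variable {V : Type*} [AddCommGroup V] [Module ℂ V] {Γ : Module.End ℂ V} {a b c : ℕ} {s κ : ℂ}
  {A A' B B' C : VertexOperator ℂ V}

/-- The derivative `∂A` of the field `A`. -/
def derivField (A : VertexOperator ℂ V) : VertexOperator ℂ V :=
  ofModes (fun m => (-m : ℂ) • A[[m - 1]]) fun v => by
    obtain ⟨N, hN⟩ := exists_modes_eq_zero A v
    exact ⟨N + 1, fun m hm => by rw [LinearMap.smul_apply, hN _ (by omega), smul_zero]⟩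

theorem HasParity.derivField (hA : HasParity Γ a A) : HasParity Γ a (derivField A) := fun m => by
  simp only [FreeFieldVOA.derivField, ncoeff_ofModes, mul_smul_comm, smul_mul_assoc, hA (m - 1),
    smul_comm (-m : ℂ)]

theorem hasPointwiseSum_opProd_opProd_right (hΓ : Γ * Γ = 1) (hA : HasParity Γ a A)
    (hB : HasParity Γ b B) (hC : HasParity Γ c C) (m : ℤ) :
    HasPointwiseSum (fun x : ℤ × ℤ => normalOrd ((-1) ^ (a * (b + c))) x.1 (A[[x.1]])
      (normalOrd ((-1) ^ (b * c)) x.2 (B[[x.2]]) (C[[m - 1 - x.1 - 1 - x.2]])))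
      ((opProd Γ 0 A (opProd Γ 0 B C))[[m]]) := by
  refine .of_fiberwise (fun p => ?_)
    (hasPointwiseSum_opProd_zero hΓ hA (hB.opProd_zero hΓ hC) m) fun v => ?_
  · exact (hasPointwiseSum_opProd_zero hΓ hB hC (m - 1 - p)).normalOrd_right _ p (A[[p]])
  · have hfin := (uniformlyTruncated_ncoeff A).finite_normalOrd
      (uniformlyTruncated_normalOrd ((-1) ^ (b * c)) B C) ((-1) ^ (a * (b + c))) (m - 1) v
    refine hfin.subset ?_
    rintro p ⟨q, hq⟩
    exact ⟨(), q, hq⟩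

theorem hasPointwiseSum_opProd_opProd_left (hΓ : Γ * Γ = 1) (hA : HasParity Γ a A)
    (hB : HasParity Γ b B) (hC : HasParity Γ c C) (m : ℤ) :
    HasPointwiseSum (fun x : ℤ × ℤ => normalOrd ((-1) ^ ((a + b) * c)) x.1
      (normalOrd ((-1) ^ (a * b)) x.2 (A[[x.2]]) (B[[x.1 - 1 - x.2]])) (C[[m - 1 - x.1]]))
      ((opProd Γ 0 (opProd Γ 0 A B) C)[[m]]) := by
  refine .of_fiberwise (fun r => ?_)
    (hasPointwiseSum_opProd_zero hΓ (hA.opProd_zero hΓ hB) hC m) fun v => ?_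
  · exact (hasPointwiseSum_opProd_zero hΓ hA hB r).normalOrd_left _ r (C[[m - 1 - r]])
  · have hfin := (uniformlyTruncated_normalOrd ((-1) ^ (a * b)) A B).finite_normalOrd
      (uniformlyTruncated_ncoeff C) ((-1) ^ ((a + b) * c)) (m - 1) v
    refine hfin.subset ?_
    rintro r ⟨p, hp⟩
    exact ⟨p, (), hp⟩

theorem normalOrd_derivField (s : ℂ) (A : VertexOperator ℂ V) (p : ℤ) (x : Module.End ℂ V) :
    normalOrd s (p + 1) ((derivField A)[[p + 1]]) x =
      (-(p + 1) : ℂ) • normalOrd s p (A[[p]]) x := by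
  rw [derivField, ncoeff_ofModes, add_sub_cancel_right]
  rcases lt_trichotomy p (-1) with hp | rfl | hp
  · rw [normalOrd_of_neg (by omega), normalOrd_of_neg (by omega), smul_mul_assoc]
    push_cast
    rfl
  · simp [normalOrd]
  · rw [normalOrd_of_nonneg (by omega), normalOrd_of_nonneg (by omega), mul_smul_comm, smul_comm]
    push_cast
    rfl

theorem hasPointwiseSum_opProd_derivField (hΓ : Γ * Γ = 1) (hA : HasParity Γ a A)
    (hB : HasParity Γ b B) (m : ℤ) :
    HasPointwiseSum (fun x : ℤ × ℤ => (negStep ℂ (x.1 + x.2 + 1) - negStep ℂ x.2) •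
      normalOrd ((-1) ^ (a * b)) x.1 (A[[x.1]]) (B[[m - 1 - 1 - x.1]]))
      ((opProd Γ 0 (derivField A) B)[[m]]) := by
  have hderiv : HasPointwiseSum (fun p : ℤ => (-(p + 1) : ℂ) •
      normalOrd ((-1) ^ (a * b)) p (A[[p]]) (B[[m - 1 - 1 - p]]))
      ((opProd Γ 0 (derivField A) B)[[m]]) := by
    convert (hasPointwiseSum_opProd_zero hΓ hA.derivField hB m).comp_equiv (Equiv.addRight 1)
      using 2 with p
    rw [Equiv.coe_addRight, normalOrd_derivField, show m - 1 - (p + 1) = m - 1 - 1 - p by ring]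
  refine .of_fiberwise (fun p => ?_) hderiv fun v => ?_
  · convert (hasPointwiseSum_negStep (p + 1) (normalOrd ((-1) ^ (a * b)) p (A[[p]])
      (B[[m - 1 - 1 - p]]))).const_smul (-1 : ℂ) using 1
    · ext1 q
      rw [show q + (p + 1) = p + q + 1 by ring]
      module
    · push_cast
      module
  · refine (finite_normalOrd_ncoeff ((-1) ^ (a * b)) A B (m - 1 - 1) v).subset fun p ⟨q, hq⟩ h => ?_
    exact hq (by simpa using .inr h)

theorem opProd_opProd_eq_add (hΓ : Γ * Γ = 1) (hA : HasParity Γ a A) (hB : HasParity Γ b B)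
    (hC : HasParity Γ c C) (hA' : HasParity Γ (a + c) A') (hB' : HasParity Γ (b + c) B')
    (hAC : HasOPE ((-1) ^ (a * c)) A C A' 0) (hBC : HasOPE ((-1) ^ (b * c)) B C B' 0) :
    opProd Γ 0 (opProd Γ 0 A B) C = opProd Γ 0 A (opProd Γ 0 B C)
      + opProd Γ 0 (derivField A) B' + (-1 : ℂ) ^ (a * b) • opProd Γ 0 (derivField B) A' := by
  refine field_ext fun m => ?_
  let reindex : ℤ × ℤ ≃ ℤ × ℤ :=
    { toFun := fun x => (x.1 + x.2 + 1, x.1)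
      invFun := fun x => (x.2, x.1 - 1 - x.2)
      left_inv := fun x => Prod.ext rfl (by ring)
      right_inv := fun x => Prod.ext (by ring) rfl }
  have hB'sum := hasPointwiseSum_opProd_derivField hΓ hA hB' m
  have hA'sum := (hasPointwiseSum_opProd_derivField hΓ hB hA' m).comp_equiv (Equiv.prodComm ℤ ℤ)
  refine ((hasPointwiseSum_opProd_opProd_left hΓ hA hB hC m).comp_equiv reindex).unique ?_
  simp only [map_add, map_smul, Pi.add_apply, Pi.smul_apply]
  convert ((hasPointwiseSum_opProd_opProd_right hΓ hA hB hC m).add hB'sum).add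
    (hA'sum.const_smul ((-1) ^ (a * b))) using 2 with x
  obtain ⟨p, q⟩ := x
  simp only [reindex, Equiv.coe_fn_mk, Equiv.prodComm_apply, Prod.swap_prod_mk]
  have hac := hAC.mul_eq p (m - 1 - 1 - p - q)
  have hbc := hBC.mul_eq q (m - 1 - 1 - p - q)
  rw [show p + (m - 1 - 1 - p - q) = m - 1 - 1 - q by ring] at hac
  rw [show q + (m - 1 - 1 - p - q) = m - 1 - 1 - p by ring] at hbc
  rw [show m - 1 - (p + q + 1) = m - 1 - 1 - p - q by ring, show p + q + 1 - 1 - p = q by ring,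
    show m - 1 - p - 1 - q = m - 1 - 1 - p - q by ring, add_mul, mul_add, mul_add, mul_comm b a,
    pow_add, pow_add, pow_add, add_comm q p, smul_comm ((-1 : ℂ) ^ (a * b)),
    normalOrd_normalOrd (neg_one_pow_mul_self _) hac hbc rfl]

theorem opProd_comm (hΓ : Γ * Γ = 1) (hA : HasParity Γ a A) (hB : HasParity Γ b B)
    (hAB : HasOPE ((-1) ^ (a * b)) A B (κ • idField V) 0) :
    opProd Γ 0 A B = (-1 : ℂ) ^ (a * b) • opProd Γ 0 B A := by
  refine field_ext fun m => ?_
  refine (hasPointwiseSum_opProd_zero hΓ hA hB m).unique ?_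
  rw [map_smul, Pi.smul_apply]
  convert ((hasPointwiseSum_opProd_zero hΓ hB hA m).comp_equiv
    (Equiv.subLeft (m - 1))).const_smul ((-1) ^ (a * b)) using 2 with p
  rw [Equiv.subLeft_apply, sub_sub_cancel, mul_comm b a]
  have hcomm (h : m ≠ 0) :
      A[[p]] * B[[m - 1 - p]] = (-1 : ℂ) ^ (a * b) • (B[[m - 1 - p]] * A[[p]]) := by
    rw [hAB.mul_eq, map_smul, Pi.smul_apply, idField, ncoeff_ofModes, if_neg (by omega), smul_zero,
      add_zero]
  rcases lt_or_ge p 0 with hp | hp <;> rcases lt_or_ge (m - 1 - p) 0 with hq | hq <;>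
    simp only [normalOrd_of_neg, normalOrd_of_nonneg, hp, hq, smul_smul, neg_one_pow_mul_self,
      one_smul]
  · exact hcomm (by omega)
  · exact (hcomm (by omega)).symm

theorem opProd_left_comm (hΓ : Γ * Γ = 1) (hA : HasParity Γ a A) (hB : HasParity Γ b B)
    (hC : HasParity Γ c C) (hA' : HasParity Γ (a + c) A') (hB' : HasParity Γ (b + c) B')
    (hAB : HasOPE ((-1) ^ (a * b)) A B (κ • idField V) 0)
    (hAC : HasOPE ((-1) ^ (a * c)) A C A' 0) (hBC : HasOPE ((-1) ^ (b * c)) B C B' 0) :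
    opProd Γ 0 A (opProd Γ 0 B C) = (-1 : ℂ) ^ (a * b) • opProd Γ 0 B (opProd Γ 0 A C) := by
  have hassoc := opProd_opProd_eq_add hΓ hA hB hC hA' hB' hAC hBC
  have hassoc' := opProd_opProd_eq_add hΓ hB hA hC hB' hA' hBC hAC
  have hcomm : opProd Γ 0 (opProd Γ 0 A B) C =
      (-1 : ℂ) ^ (a * b) • opProd Γ 0 (opProd Γ 0 B A) C := by
    rw [opProd_comm hΓ hA hB hAB]
    exact (opProdₗ Γ 0).map_smul₂ _ _ _
  rw [hassoc, hassoc', mul_comm b a] at hcomm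
  linear_combination (norm := module)
    hcomm + neg_one_pow_mul_self (a * b) • opProd Γ 0 (derivField A) B'

theorem opProd_idField_right (hΓ : Γ * Γ = 1) (hA : HasParity Γ a A) :
    opProd Γ 0 A (idField V) = A := by
  refine field_ext fun m => (hasPointwiseSum_opProd_zero hΓ hA .idField m).unique ?_
  convert HasPointwiseSum.single m (A[[m]]) using 2 with p
  rcases eq_or_ne p m with rfl | hp
  · simp [normalOrd, idField]
  · rw [idField, ncoeff_ofModes, if_neg (by omega), if_neg hp, normalOrd, mul_zero, zero_mul,
      smul_zero, ite_self]

theorem opProd_idField_left (hΓ : Γ * Γ = 1) (hA : HasParity Γ a A) :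
    opProd Γ 0 (idField V) A = A := by
  refine field_ext fun m => (hasPointwiseSum_opProd_zero hΓ .idField hA m).unique ?_
  convert HasPointwiseSum.single (-1) (A[[m]]) using 2 with p
  rcases eq_or_ne p (-1) with rfl | hp
  · simp [normalOrd, idField]
  · rw [idField, ncoeff_ofModes, if_neg hp, if_neg hp, normalOrd, mul_zero, zero_mul, smul_zero,
      ite_self]

end QuasiAssociativity

/-! ### The operator products of the generators -/

section Generators

variable {n : ℕ}

theorem involute_contractLeft {R M : Type*} [CommRing R] [AddCommGroup M] [Module R M]
    {Q : QuadraticForm R M} (d : Module.Dual R M) (x : CliffordAlgebra Q) :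
    CliffordAlgebra.involute (CliffordAlgebra.contractLeft d x) =
      -CliffordAlgebra.contractLeft d (CliffordAlgebra.involute x) := by
  induction x using CliffordAlgebra.left_induction with
  | algebraMap r => simp
  | add x y hx hy => simp only [map_add, hx, hy, neg_add]
  | ι_mul x u hx =>
    simp only [CliffordAlgebra.contractLeft_ι_mul, map_sub, map_mul, map_smul,
      CliffordAlgebra.involute_ι, hx, neg_mul, map_neg]
    simp

theorem pderiv_pderiv_comm {R σ : Type*} [CommRing R] (x y : σ) (f : MvPolynomial σ R) :
    MvPolynomial.pderiv x (MvPolynomial.pderiv y f) =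
      MvPolynomial.pderiv y (MvPolynomial.pderiv x f) := by
  classical
  have h : ⁅MvPolynomial.pderiv x, MvPolynomial.pderiv (R := R) y⁆ = 0 :=
    MvPolynomial.derivation_ext fun i => by
      rw [Derivation.commutator_apply, MvPolynomial.pderiv_X, MvPolynomial.pderiv_X,
        Pi.single_apply, Pi.single_apply]
      split_ifs <;> simp
  have := DFunLike.congr_fun h f
  rw [Derivation.commutator_apply] at this
  exact sub_eq_zero.1 this

theorem pderiv_X_mul {R σ : Type*} [CommSemiring R] [DecidableEq σ] (x y : σ)
    (f : MvPolynomial σ R) : MvPolynomial.pderiv x (MvPolynomial.X y * f) =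
      MvPolynomial.X y * MvPolynomial.pderiv x f + if y = x then f else 0 := by
  rw [MvPolynomial.pderiv_mul, add_comm, MvPolynomial.pderiv_X, Pi.single_apply, ite_mul, one_mul,
    zero_mul]

theorem parity_mul_parity (n : ℕ) : parity n * parity n = 1 := by
  rw [parity, ← LinearMap.lTensor_mul]
  exact (congrArg _ (LinearMap.ext CliffordAlgebra.involute_involute)).trans
    (LinearMap.lTensor_id _ _)

theorem ncoeff_bosonField (φ : Boson n) (m : ℤ) :
    (bosonField φ)[[m]] = LinearMap.rTensor (FermionFock n) (bosonMode φ m) :=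
  ncoeff_ofModes _ _ _

theorem ncoeff_fermionField (φ : Fermion n) (m : ℤ) :
    (fermionField φ)[[m]] = LinearMap.lTensor (BosonFock n) (fermionMode φ m) :=
  ncoeff_ofModes _ _ _

theorem ncoeff_smul_idField {V : Type*} [AddCommGroup V] [Module ℂ V] (c : ℂ) (m : ℤ) :
    (c • idField V)[[m]] = (if m = -1 then c else 0) • 1 := by
  rw [map_smul, Pi.smul_apply, idField, ncoeff_ofModes, smul_ite, smul_zero, ite_smul, zero_smul]

theorem HasOPE.smul_idField_left {V : Type*} [AddCommGroup V] [Module ℂ V] (c : ℂ)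
    (B : VertexOperator ℂ V) : HasOPE 1 (c • idField V) B 0 0 := fun p q => by
  simp [ncoeff_smul_idField]

/-- The boson whose operator product with the given one is singular. -/
def Boson.dual : Boson n → Boson n
  | .X i => .Y i
  | .Y i => .X i

/-- The residue of the operator product of a boson with its dual. -/
def Boson.sign : Boson n → ℂ
  | .X _ => 1
  | .Y _ => -1

theorem Boson.eq_dual_comm {φ θ : Boson n} : θ = φ.dual ↔ φ = θ.dual := by
  cases φ <;> cases θ <;> simp [Boson.dual, eq_comm]

theorem Boson.sign_dual (φ : Boson n) : φ.dual.sign = -φ.sign := by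
  cases φ <;> simp [Boson.dual, Boson.sign]

theorem Fermion.eq_dual_comm {φ θ : Fermion n} : θ = φ.dual ↔ φ = θ.dual := by
  cases φ <;> cases θ <;> simp [Fermion.dual, eq_comm]

open Classical in
/-- The residue of the operator product of two bosons. -/
def bosonPairing (φ θ : Boson n) : ℂ := if θ = φ.dual then φ.sign else 0

open Classical in
/-- The residue of the operator product of two fermions. -/
def fermionPairing (φ θ : Fermion n) : ℂ := if θ = φ.dual then 1 else 0

theorem bosonPairing_antisymm (φ θ : Boson n) : bosonPairing φ θ = -bosonPairing θ φ := by
  rw [bosonPairing, bosonPairing, Boson.eq_dual_comm]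
  split_ifs with h
  · rw [h, Boson.sign_dual]
  · rw [neg_zero]

theorem fermionPairing_comm (φ θ : Fermion n) : fermionPairing φ θ = fermionPairing θ φ := by
  rw [fermionPairing, fermionPairing, Fermion.eq_dual_comm]

theorem bosonMode_natCast (φ : Boson n) (m : ℕ) (f : BosonFock n) :
    bosonMode φ m f = φ.sign • MvPolynomial.pderiv (φ.dual, m) f := by
  cases φ <;> simp [bosonMode, Boson.sign, Boson.dual]

theorem bosonMode_negSucc (φ : Boson n) (m : ℕ) (f : BosonFock n) :
    bosonMode φ (Int.negSucc m) f = MvPolynomial.X (φ, m) * f := by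
  cases φ <;> rfl

theorem bosonMode_natCast_negSucc (φ θ : Boson n) (p q : ℕ) (f : BosonFock n) :
    bosonMode φ p (bosonMode θ (Int.negSucc q) f) =
      bosonMode θ (Int.negSucc q) (bosonMode φ p f)
        + (if p = q then bosonPairing φ θ else 0) • f := by
  classical
  simp only [bosonMode_natCast, bosonMode_negSucc, pderiv_X_mul, smul_add, mul_smul_comm,
    Prod.mk.injEq, bosonPairing, eq_comm (a := q), add_right_inj]
  split_ifs <;> simp_all

theorem bosonMode_mul_bosonMode (φ θ : Boson n) (p q : ℤ) :
    bosonMode φ p * bosonMode θ q =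
      bosonMode θ q * bosonMode φ p + (if p + q = -1 then bosonPairing φ θ else 0) • 1 := by
  refine LinearMap.ext fun f => ?_
  simp only [LinearMap.add_apply, LinearMap.smul_apply, Module.End.mul_apply, Module.End.one_apply]
  rcases p with p | p <;> rcases q with q | q
  · rw [if_neg (by grind), zero_smul, add_zero]
    simp only [Int.ofNat_eq_natCast, bosonMode_natCast, map_smul,
      pderiv_pderiv_comm (φ.dual, p), smul_comm φ.sign]
  · rw [Int.ofNat_eq_natCast, bosonMode_natCast_negSucc,
      if_congr (show (p : ℤ) + Int.negSucc q = -1 ↔ p = q by omega) rfl rfl]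
  · rw [Int.ofNat_eq_natCast, bosonMode_natCast_negSucc, bosonPairing_antisymm φ,
      if_congr (show Int.negSucc p + (q : ℤ) = -1 ↔ q = p by omega) rfl rfl]
    split_ifs <;> simp
  · rw [if_neg (by omega), zero_smul, add_zero]
    simp only [bosonMode_negSucc]
    exact mul_left_comm _ _ _

theorem fermionMode_natCast_negSucc (φ θ : Fermion n) (p q : ℕ) (x : FermionFock n) :
    fermionMode φ p (fermionMode θ (Int.negSucc q) x) =
      (if p = q then fermionPairing φ θ else 0) • x
        - fermionMode θ (Int.negSucc q) (fermionMode φ p x) := by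
  classical
  refine (CliffordAlgebra.contractLeft_ι_mul _ _ _).trans ?_
  congr 2
  simp only [Finsupp.lapply_apply, Finsupp.single_apply, Prod.mk.injEq, fermionPairing]
  split_ifs <;> simp_all

theorem fermionMode_mul_fermionMode (φ θ : Fermion n) (p q : ℤ) :
    fermionMode φ p * fermionMode θ q =
      -(fermionMode θ q * fermionMode φ p)
        + (if p + q = -1 then fermionPairing φ θ else 0) • 1 := by
  refine LinearMap.ext fun x => ?_
  simp only [LinearMap.add_apply, LinearMap.neg_apply, LinearMap.smul_apply, Module.End.mul_apply,
    Module.End.one_apply]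
  rcases p with p | p <;> rcases q with q | q
  · rw [if_neg (by grind), zero_smul, add_zero]
    exact CliffordAlgebra.contractLeft_comm ..
  · rw [Int.ofNat_eq_natCast, fermionMode_natCast_negSucc,
      if_congr (show (p : ℤ) + Int.negSucc q = -1 ↔ p = q by omega) rfl rfl, neg_add_eq_sub]
  · rw [Int.ofNat_eq_natCast, fermionMode_natCast_negSucc, fermionPairing_comm,
      if_congr (show Int.negSucc p + (q : ℤ) = -1 ↔ q = p by omega) rfl rfl, neg_sub,
      sub_add_cancel]
  · rw [if_neg (by omega), zero_smul, add_zero]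
    simp only [fermionMode, LinearMap.mulLeft_apply, ← mul_assoc]
    rw [eq_neg_of_add_eq_zero_left (ExteriorAlgebra.ι_add_mul_swap _ _), neg_mul]

theorem nop_eq_opProd (A B : VertexOperator ℂ (Fock n)) : nop A B = opProd (parity n) 0 A B := rfl

theorem nop_add_left (A A' B : VertexOperator ℂ (Fock n)) :
    nop (A + A') B = nop A B + nop A' B := (opProdₗ (parity n) 0).map_add₂ A A' B

theorem nop_add_right (A B B' : VertexOperator ℂ (Fock n)) :
    nop A (B + B') = nop A B + nop A B' := (opProdₗ (parity n) 0 A).map_add B B'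

theorem nop_smul_left (c : ℂ) (A B : VertexOperator ℂ (Fock n)) : nop (c • A) B = c • nop A B :=
  (opProdₗ (parity n) 0).map_smul₂ c A B

theorem nop_smul_right (c : ℂ) (A B : VertexOperator ℂ (Fock n)) : nop A (c • B) = c • nop A B :=
  (opProdₗ (parity n) 0 A).map_smul c B

theorem nop_zero_left (A : VertexOperator ℂ (Fock n)) : nop 0 A = 0 :=
  (opProdₗ (parity n) 0).map_zero₂ A

theorem nop_zero_right (A : VertexOperator ℂ (Fock n)) : nop A 0 = 0 :=
  (opProdₗ (parity n) 0 A).map_zero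

theorem nop_neg_left (A B : VertexOperator ℂ (Fock n)) : nop (-A) B = -nop A B :=
  (opProdₗ (parity n) 0).map_neg₂ A B

theorem nop_neg_right (A B : VertexOperator ℂ (Fock n)) : nop A (-B) = -nop A B :=
  (opProdₗ (parity n) 0 A).map_neg B

theorem nop_sub_left (A A' B : VertexOperator ℂ (Fock n)) :
    nop (A - A') B = nop A B - nop A' B := (opProdₗ (parity n) 0).map_sub₂ A A' B

theorem nop_sum_left {ι : Type*} (t : Finset ι) (A : ι → VertexOperator ℂ (Fock n))
    (B : VertexOperator ℂ (Fock n)) : nop (∑ i ∈ t, A i) B = ∑ i ∈ t, nop (A i) B :=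
  (opProdₗ (parity n) 0).map_sum₂ t A B

theorem nop_sum_right {ι : Type*} (t : Finset ι) (A : VertexOperator ℂ (Fock n))
    (B : ι → VertexOperator ℂ (Fock n)) : nop A (∑ i ∈ t, B i) = ∑ i ∈ t, nop A (B i) :=
  map_sum (opProdₗ (parity n) 0 A) B t

theorem nop_idField_left {e : ℕ} {A : VertexOperator ℂ (Fock n)} (hA : HasParity (parity n) e A) :
    nop (idField (Fock n)) A = A := opProd_idField_left (parity_mul_parity n) hA

theorem nop_idField_right {e : ℕ} {A : VertexOperator ℂ (Fock n)} (hA : HasParity (parity n) e A) :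
    nop A (idField (Fock n)) = A := opProd_idField_right (parity_mul_parity n) hA

/-- The labels of the generators. -/
abbrev Label (n : ℕ) : Type := Boson n ⊕ Fermion n

/-- The generating field with a given label. -/
def gen : Label n → VertexOperator ℂ (Fock n)
  | .inl φ => bosonField φ
  | .inr φ => fermionField φ

/-- The parity of the generating field with a given label, as the exponent of a sign. -/
def genParity : Label n → ℕ
  | .inl _ => 0
  | .inr _ => 1

/-- The residue of the operator product of two generators. -/
def pairing : Label n → Label n → ℂ
  | .inl φ, .inl θ => bosonPairing φ θ
  | .inr φ, .inr θ => fermionPairing φ θ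
  | _, _ => 0

theorem hasParity_gen (g : Label n) : HasParity (parity n) (genParity g) (gen g) := fun m => by
  rcases g with φ | φ <;> simp only [gen, genParity]
  · rw [ncoeff_bosonField, parity, pow_zero, one_smul]
    simp only [Module.End.mul_eq_comp, LinearMap.lTensor_comp_rTensor,
      LinearMap.rTensor_comp_lTensor]
  · rw [ncoeff_fermionField, parity, pow_one, ← LinearMap.lTensor_mul, ← LinearMap.lTensor_mul,
      ← LinearMap.lTensor_smul]
    congr 1
    ext x
    rcases m with m | m
    · simp [fermionMode, involute_contractLeft]
    · simp [fermionMode, ExteriorAlgebra.ι]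

theorem hasOPE_gen_gen (g h : Label n) :
    HasOPE ((-1) ^ (genParity g * genParity h)) (gen g) (gen h) (pairing g h • idField (Fock n))
      0 := fun p q => by
  rw [map_zero, Pi.zero_apply, smul_zero, add_zero, ncoeff_smul_idField]
  rcases g with φ | φ <;> rcases h with θ | θ <;>
    simp only [gen, genParity, pairing, mul_zero, mul_one, pow_zero, pow_one, one_smul, ite_self,
      zero_smul, add_zero, ncoeff_bosonField, ncoeff_fermionField]
  · rw [← LinearMap.rTensor_mul, ← LinearMap.rTensor_mul, bosonMode_mul_bosonMode,
      LinearMap.rTensor_add, LinearMap.rTensor_smul, Module.End.one_eq_id, LinearMap.rTensor_id,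
      Module.End.one_eq_id]
  · simp only [Module.End.mul_eq_comp, LinearMap.lTensor_comp_rTensor,
      LinearMap.rTensor_comp_lTensor]
  · simp only [Module.End.mul_eq_comp, LinearMap.lTensor_comp_rTensor,
      LinearMap.rTensor_comp_lTensor]
  · rw [← LinearMap.lTensor_mul, ← LinearMap.lTensor_mul, fermionMode_mul_fermionMode,
      LinearMap.lTensor_add, LinearMap.lTensor_neg, LinearMap.lTensor_smul, Module.End.one_eq_id,
      LinearMap.lTensor_id, Module.End.one_eq_id]
    exact congrArg (· + _) (LinearMap.ext fun v => (neg_one_smul ℂ _).symm)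

theorem pairing_eq_zero_or_even (g h : Label n) :
    pairing g h = 0 ∨ Even (genParity g + genParity h) := by
  rcases g with φ | φ <;> rcases h with θ | θ <;> simp [pairing, genParity]

theorem hasParity_pairing_smul_idField (g h : Label n) :
    HasParity (parity n) (genParity g + genParity h) (pairing g h • idField (Fock n)) := by
  rcases pairing_eq_zero_or_even g h with hgh | hgh
  · rw [hgh, zero_smul]
    exact .zero
  · exact (HasParity.idField.smul (pairing g h)).of_even_add (by rwa [zero_add])

theorem hasOPE_pairing_smul_idField (g h k : Label n) :
    HasOPE ((-1) ^ ((genParity g + genParity h) * genParity k)) (pairing g h • idField (Fock n))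
      (gen k) 0 0 := by
  rcases pairing_eq_zero_or_even g h with hgh | hgh
  · intro p q
    simp [hgh]
  · rw [(hgh.mul_right _).neg_one_pow]
    exact .smul_idField_left _ _

/-- The residue of the operator product of a generator with the normally ordered product of two
generators. -/
def contraction (g h k : Label n) : VertexOperator ℂ (Fock n) :=
  pairing g h • gen k + ((-1) ^ (genParity g * genParity h) * pairing g k) • gen h

theorem hasParity_contraction (g h k : Label n) :
    HasParity (parity n) (genParity g + (genParity h + genParity k)) (contraction g h k) := by
  refine .add ?_ ?_
  · rcases pairing_eq_zero_or_even g h with hgh | hgh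
    · rw [hgh, zero_smul]
      exact .zero
    · exact ((hasParity_gen k).smul _).of_even_add (by grind)
  · rcases pairing_eq_zero_or_even g k with hgk | hgk
    · rw [hgk, mul_zero, zero_smul]
      exact .zero
    · exact ((hasParity_gen h).smul _).of_even_add (by grind)

theorem hasOPE_gen_nop (g h k : Label n) :
    HasOPE ((-1) ^ (genParity g * (genParity h + genParity k))) (gen g) (nop (gen h) (gen k))
      (contraction g h k) 0 := by
  have hwick := (hasOPE_gen_gen g h).opProd_zero (hasOPE_gen_gen g k)
    (hasOPE_pairing_smul_idField g h k) (parity_mul_parity n) (hasParity_gen h) (hasParity_gen k)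
    (hasParity_pairing_smul_idField g h) (hasParity_pairing_smul_idField g k)
  rw [← nop_eq_opProd, ← nop_eq_opProd, ← nop_eq_opProd, nop_smul_left, nop_smul_right,
    nop_idField_left (hasParity_gen k), nop_idField_right (hasParity_gen h), smul_smul] at hwick
  exact hwick

theorem hasParity_nop_gen (g h : Label n) :
    HasParity (parity n) (genParity g + genParity h) (nop (gen g) (gen h)) :=
  (hasParity_gen g).opProd_zero (parity_mul_parity n) (hasParity_gen h)

end Generators

/-! ### The gauge currents -/

section Currents

variable {n : ℕ}

open Classical in
/-- The charge of a generator under the `j`-th current `X_j Y_j + ψ_j χ_j`. -/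
def charge (j : Fin n) : Label n → ℂ
  | .inl (.X i) => if i = j then -1 else 0
  | .inl (.Y i) => if i = j then 1 else 0
  | .inr (.psi i) => if i = j then 1 else 0
  | .inr (.chi i) => if i = j then -1 else 0
  | .inr (.b _) => 0
  | .inr (.c _) => 0

theorem current_eq (j : Fin n) :
    current j = nop (gen (.inl (.X j))) (gen (.inl (.Y j)))
      + nop (gen (.inr (.psi j))) (gen (.inr (.chi j))) := rfl

theorem hasParity_current (j : Fin n) : HasParity (parity n) 0 (current j) := by
  rw [current_eq]
  exact (hasParity_nop_gen (.inl (.X j)) (.inl (.Y j))).add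
    ((hasParity_nop_gen (.inr (.psi j)) (.inr (.chi j))).of_even_add (by simp [genParity]))

theorem hasOPE_current_gen (j : Fin n) (g : Label n) :
    HasOPE 1 (current j) (gen g) (charge j g • gen g) 0 := by
  have hsign_boson : (-1 : ℂ) ^ (genParity g * (0 + 0)) = 1 := by simp
  have hsign_fermion : (-1 : ℂ) ^ (genParity g * (1 + 1)) = 1 := by simp [mul_comm _ 2, pow_mul]
  have hboson := (hasOPE_gen_nop g (.inl (.X j)) (.inl (.Y j))).symm (neg_one_pow_mul_self _)
  have hfermion := (hasOPE_gen_nop g (.inr (.psi j)) (.inr (.chi j))).symm (neg_one_pow_mul_self _)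
  simp only [genParity] at hsign_boson hsign_fermion hboson hfermion
  rw [hsign_boson] at hboson
  rw [hsign_fermion] at hfermion
  rw [current_eq]
  convert hboson.add_left hfermion using 1
  · rcases g with (i | i) | i | i | a | a <;>
      simp only [charge, contraction, genParity, pairing, bosonPairing, fermionPairing,
        Boson.dual, Fermion.dual, Boson.sign, Boson.X.injEq, Boson.Y.injEq, Fermion.psi.injEq,
        Fermion.chi.injEq, reduceCtorEq, if_false, eq_comm (a := j)]
    case b | c => module
    all_goals
      split_ifs with hij
      · subst hij
        module
      · module
  · rw [add_zero]

theorem hasOPE_current_nop_gen (j : Fin n) (g h : Label n) :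
    HasOPE 1 (current j) (nop (gen g) (gen h)) ((charge j g + charge j h) • nop (gen g) (gen h))
      ((charge j g * pairing g h) • idField (Fock n)) := by
  have hgen (k : Label n) :
      HasOPE ((-1) ^ (0 * genParity k)) (current j) (gen k) (charge j k • gen k) 0 := by
    simpa using hasOPE_current_gen j k
  have hparity (k : Label n) : HasParity (parity n) (0 + genParity k) (charge j k • gen k) := by
    simpa using (hasParity_gen k).smul (charge j k)
  have hcontract : HasOPE ((-1) ^ ((0 + genParity g) * genParity h)) (charge j g • gen g) (gen h)
      ((charge j g * pairing g h) • idField (Fock n)) 0 := by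
    simpa [mul_smul] using (hasOPE_gen_gen g h).smul_left (charge j g)
  have hwick := (hgen g).opProd_zero (hgen h) hcontract (parity_mul_parity n) (hasParity_gen g)
    (hasParity_gen h) (hparity g) (hparity h)
  rw [add_smul, ← nop_smul_left, ← nop_smul_right]
  simpa only [zero_mul, pow_zero, one_smul] using! hwick

/-- The levels of the bosonic and of the fermionic summand of a current are opposite. -/
theorem hasOPE_current_current (i j : Fin n) : HasOPE 1 (current i) (current j) 0 0 := by
  rw [current_eq j]
  convert (hasOPE_current_nop_gen i (.inl (.X j)) (.inl (.Y j))).add_right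
    (hasOPE_current_nop_gen i (.inr (.psi j)) (.inr (.chi j))) using 1 <;>
  · simp only [charge, pairing, bosonPairing, fermionPairing, Boson.dual, Fermion.dual, Boson.sign,
      if_true, ← add_smul]
    split_ifs <;> simp

theorem nop_current_comm (i j : Fin n) :
    nop (current i) (current j) = nop (current j) (current i) := by
  have h := opProd_comm (κ := 0) (parity_mul_parity n) (hasParity_current i)
    (hasParity_current j) (by simpa using hasOPE_current_current i j)
  rwa [mul_zero, pow_zero, one_smul] at h

end Currents

/-! ### BRST exactness -/

section BRST

variable {n : ℕ}

/-- The difference of consecutive currents, which is the coefficient of the ghost `cᵃ` in the BRST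
current. -/
def currentDiff (a : Fin (n - 1)) : VertexOperator ℂ (Fock n) :=
  current ⟨a, by omega⟩ - current ⟨a + 1, by omega⟩

theorem brstCurrent_eq_sum (n : ℕ) :
    brstCurrent n = ∑ a : Fin (n - 1), nop (gen (.inr (.c a))) (currentDiff a) := rfl

theorem hasParity_currentDiff (a : Fin (n - 1)) : HasParity (parity n) 0 (currentDiff a) :=
  (hasParity_current _).sub (hasParity_current _)

theorem hasParity_brstCurrent (n : ℕ) : HasParity (parity n) (1 + 0) (brstCurrent n) := by
  have hghost (a : Fin (n - 1)) : HasParity (parity n) 1 (gen (.inr (.c a))) :=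
    hasParity_gen (.inr (.c a))
  rw [brstCurrent_eq_sum]
  refine .sum fun a _ => ?_
  rw [nop_eq_opProd]
  exact (hghost a).opProd_zero (parity_mul_parity n) (hasParity_currentDiff a)

theorem hasOPE_currentDiff_ghostB (a a' : Fin (n - 1)) :
    HasOPE 1 (currentDiff a) (gen (.inr (.b a'))) 0 0 := by
  simpa [charge, currentDiff] using (hasOPE_current_gen ⟨a, by omega⟩ (.inr (.b a'))).sub_left
    (hasOPE_current_gen ⟨a + 1, by omega⟩ (.inr (.b a')))

theorem hasOPE_currentDiff_current (a : Fin (n - 1)) (j : Fin n) :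
    HasOPE 1 (currentDiff a) (current j) 0 0 := by
  simpa [currentDiff] using (hasOPE_current_current ⟨a, by omega⟩ j).sub_left
    (hasOPE_current_current ⟨a + 1, by omega⟩ j)

theorem hasOPE_ghostB_brstSummand (a a' : Fin (n - 1)) :
    HasOPE (-1) (gen (.inr (.b a'))) (nop (gen (.inr (.c a))) (currentDiff a))
      (pairing (.inr (.b a')) (.inr (.c a)) • currentDiff a) 0 := by
  have hghost : HasOPE ((-1) ^ (1 * 0)) (gen (.inr (.b a'))) (currentDiff a) 0 0 := by
    simpa using (hasOPE_currentDiff_ghostB a a').symm (one_mul 1)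
  have hpole : HasOPE ((-1) ^ ((1 + 1) * 0))
      (pairing (.inr (.b a')) (.inr (.c a)) • idField (Fock n)) (currentDiff a) 0 0 := by
    simpa using HasOPE.smul_idField_left _ (currentDiff a)
  have hwick := (hasOPE_gen_gen (.inr (.b a')) (.inr (.c a))).opProd_zero hghost hpole
    (parity_mul_parity n) (hasParity_gen (.inr (.c a))) (hasParity_currentDiff a)
    (hasParity_pairing_smul_idField (.inr (.b a')) (.inr (.c a))) .zero
  simp only [← nop_eq_opProd, nop_smul_left, nop_zero_right, smul_zero, add_zero,
    nop_idField_left (hasParity_currentDiff a)] at hwick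
  simpa [genParity] using hwick

theorem hasOPE_current_brstSummand (j : Fin n) (a : Fin (n - 1)) :
    HasOPE 1 (current j) (nop (gen (.inr (.c a))) (currentDiff a)) 0 0 := by
  have hghost : HasOPE ((-1) ^ (0 * 1)) (current j) (gen (.inr (.c a))) 0 0 := by
    simpa [charge] using hasOPE_current_gen j (.inr (.c a))
  have hcurrent : HasOPE ((-1) ^ (0 * 0)) (current j) (currentDiff a) 0 0 := by
    simpa using (hasOPE_currentDiff_current a j).symm (one_mul 1)
  have hwick := hghost.opProd_zero hcurrent (P := 0) (fun p q => by simp) (parity_mul_parity n)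
    (hasParity_gen (.inr (.c a))) (hasParity_currentDiff a) .zero .zero
  simp only [← nop_eq_opProd, nop_zero_left, nop_zero_right, smul_zero, add_zero] at hwick
  simpa using hwick

theorem hasOPE_brstCurrent_ghostB (a : Fin (n - 1)) :
    HasOPE (-1) (brstCurrent n) (gen (.inr (.b a))) (currentDiff a) 0 := by
  have hsum := HasOPE.sum_left (t := Finset.univ) fun a' _ =>
    (hasOPE_ghostB_brstSummand a' a).symm (by norm_num)
  rw [Finset.sum_const_zero, ← brstCurrent_eq_sum] at hsum
  convert hsum using 1
  have hpairing (a' : Fin (n - 1)) : -((-1 : ℂ) • pairing (.inr (.b a)) (.inr (.c a')) •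
      currentDiff a') = if a = a' then currentDiff a' else 0 := by
    simp only [pairing, fermionPairing, Fermion.dual, Fermion.c.injEq, eq_comm (a := a')]
    split_ifs <;> module
  rw [Finset.sum_congr rfl fun a' _ => hpairing a', Finset.sum_ite_eq, if_pos (Finset.mem_univ a)]

theorem hasOPE_brstCurrent_current (j : Fin n) : HasOPE 1 (brstCurrent n) (current j) 0 0 := by
  have hsum := HasOPE.sum_left (t := Finset.univ) fun a _ =>
    (hasOPE_current_brstSummand j a).symm (one_mul 1)
  simpa [brstCurrent_eq_sum] using hsum

theorem brst_nop_ghostB_current (a : Fin (n - 1)) (j : Fin n) :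
    brst (nop (gen (.inr (.b a))) (current j)) = nop (currentDiff a) (current j) := by
  have hΓ := parity_mul_parity n
  have hb : HasParity (parity n) 1 (gen (.inr (.b a))) := hasParity_gen (.inr (.b a))
  have hghost : HasOPE ((-1) ^ (1 * 1)) (brstCurrent n) (gen (.inr (.b a))) (currentDiff a) 0 := by
    simpa using hasOPE_brstCurrent_ghostB a
  have hcurrent : HasOPE ((-1) ^ (1 * 0)) (brstCurrent n) (current j) 0 0 := by
    simpa using hasOPE_brstCurrent_current j
  have hpole : HasOPE ((-1) ^ ((1 + 1) * 0)) (currentDiff a) (current j) 0 0 := by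
    simpa using hasOPE_currentDiff_current a j
  have hdiff : HasParity (parity n) (1 + 1) (currentDiff a) :=
    (hasParity_currentDiff a).of_even_add (by decide)
  have hwick := hghost.opProd_zero hcurrent hpole hΓ hb (hasParity_current j) hdiff .zero
  have hparity : HasParity (parity n) (1 + 0) (nop (gen (.inr (.b a))) (current j)) := by
    rw [nop_eq_opProd]
    exact hb.opProd_zero hΓ (hasParity_current j)
  rw [← nop_eq_opProd, ← nop_eq_opProd, ← nop_eq_opProd, nop_zero_right, smul_zero,
    add_zero (nop _ _)] at hwick
  rw [brst]
  exact hwick.opProd_one hΓ (hasParity_brstCurrent n) hparity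

/-- The space of BRST exact operators. -/
def brstExact (n : ℕ) : Submodule ℂ (VertexOperator ℂ (Fock n)) :=
  (operators n).map (opProdₗ (parity n) 1 (brstCurrent n))

theorem brstEquiv_iff {A B : VertexOperator ℂ (Fock n)} :
    BRSTEquiv A B ↔ A ≡ B [SMOD brstExact n] := by
  rw [SModEq.sub_mem, BRSTEquiv, brstExact, Submodule.mem_map]
  exact exists_congr fun C => and_congr_right fun _ => eq_comm

theorem opProd_mem_operators {A B : VertexOperator ℂ (Fock n)} (p : ℤ) (hA : A ∈ operators n)
    (hB : B ∈ operators n) : opProd (parity n) p A B ∈ operators n := by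
  rw [operators, operatorSpace, Submodule.mem_sInf] at *
  exact fun S hS => hS.2.2 p A (hA S hS) B (hB S hS)

theorem gen_mem_operators (g : Label n) : gen g ∈ operators n := by
  rw [operators, operatorSpace, Submodule.mem_sInf]
  refine fun S hS => hS.2.1 ?_
  rcases g with φ | φ
  · exact Or.inl ⟨φ, rfl⟩
  · exact Or.inr ⟨φ, rfl⟩

theorem current_mem_operators (j : Fin n) : current j ∈ operators n :=
  add_mem
    (opProd_mem_operators 0 (gen_mem_operators (.inl (.X j))) (gen_mem_operators (.inl (.Y j))))
    (opProd_mem_operators 0 (gen_mem_operators (.inr (.psi j))) (gen_mem_operators (.inr (.chi j))))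

theorem nop_currentDiff_current_mem_brstExact (a : Fin (n - 1)) (j : Fin n) :
    nop (currentDiff a) (current j) ∈ brstExact n :=
  ⟨_, opProd_mem_operators 0 (gen_mem_operators (.inr (.b a))) (current_mem_operators j),
    brst_nop_ghostB_current a j⟩

theorem nop_current_smodEq (i j k : Fin n) :
    nop (current i) (current k) ≡ nop (current j) (current k) [SMOD brstExact n] := by
  have h_zero (m : ℕ) (hm : m < n) : nop (current ⟨0, by omega⟩) (current k) ≡
      nop (current ⟨m, hm⟩) (current k) [SMOD brstExact n] := by
    induction m with
    | zero => rfl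
    | succ m ih =>
      refine (ih (by omega)).trans (SModEq.sub_mem.2 ?_)
      rw [← nop_sub_left]
      exact nop_currentDiff_current_mem_brstExact ⟨m, by omega⟩ k
  exact (h_zero i i.2).symm.trans (h_zero j j.2)

theorem nop_current_current_smodEq (i j k : Fin n) :
    nop (current j) (current k) ≡ nop (current i) (current i) [SMOD brstExact n] := by
  refine (nop_current_smodEq j i k).trans ?_
  rw [nop_current_comm i k]
  exact nop_current_smodEq k i i

theorem U_add_UF (n : ℕ) : U n + UF n = -(1 / n : ℂ) • ∑ j, current j := by
  rw [U, UF, ← smul_add, ← Finset.sum_add_distrib]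
  rfl

theorem nop_U_add_UF_smodEq (i : Fin n) :
    nop (U n + UF n) (U n + UF n) ≡ nop (current i) (current i) [SMOD brstExact n] := by
  have hn : (n : ℂ) ≠ 0 := Nat.cast_ne_zero.2 i.pos.ne'
  have hsum : ∑ j : Fin n, ∑ k : Fin n, nop (current j) (current k) ≡
      ∑ _j : Fin n, ∑ _k : Fin n, nop (current i) (current i) [SMOD brstExact n] :=
    .sum fun j _ => .sum fun k _ => nop_current_current_smodEq i j k
  convert hsum.smul ((1 / n) ^ 2 : ℂ) using 1
  · rw [U_add_UF, nop_smul_left, nop_smul_right, nop_sum_left]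
    simp only [nop_sum_right, smul_smul]
    congr 1
    ring
  · simp only [Finset.sum_const, Finset.card_univ, Fintype.card_fin, ← Nat.cast_smul_eq_nsmul ℂ,
      smul_smul]
    rw [show ((1 / n) ^ 2 * (n * n) : ℂ) = 1 by field_simp, one_smul]

end BRST

/-! ### The exact identity for `Tᵢ` -/

section Identity

variable {n : ℕ}

theorem nop_nop_gen (g h k l : Label n) :
    nop (nop (gen g) (gen h)) (nop (gen k) (gen l)) =
      nop (gen g) (nop (gen h) (nop (gen k) (gen l)))
        + nop (derivField (gen g)) (contraction h k l)
        + (-1 : ℂ) ^ (genParity g * genParity h) •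
          nop (derivField (gen h)) (contraction g k l) :=
  opProd_opProd_eq_add (parity_mul_parity n) (hasParity_gen g) (hasParity_gen h)
    (hasParity_nop_gen k l) (hasParity_contraction g k l) (hasParity_contraction h k l)
    (hasOPE_gen_nop g k l) (hasOPE_gen_nop h k l)

theorem nop_gen_comm (g h : Label n) :
    nop (gen g) (gen h) = (-1 : ℂ) ^ (genParity g * genParity h) • nop (gen h) (gen g) :=
  opProd_comm (parity_mul_parity n) (hasParity_gen g) (hasParity_gen h) (hasOPE_gen_gen g h)

theorem nop_gen_left_comm (g h k : Label n) :
    nop (gen g) (nop (gen h) (gen k)) =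
      (-1 : ℂ) ^ (genParity g * genParity h) • nop (gen h) (nop (gen g) (gen k)) :=
  opProd_left_comm (parity_mul_parity n) (hasParity_gen g) (hasParity_gen h) (hasParity_gen k)
    (hasParity_pairing_smul_idField g k) (hasParity_pairing_smul_idField h k) (hasOPE_gen_gen g h)
    (hasOPE_gen_gen g k) (hasOPE_gen_gen h k)

theorem nop_gen_left_comm_nop (g h k l : Label n) :
    nop (gen g) (nop (gen h) (nop (gen k) (gen l))) =
      (-1 : ℂ) ^ (genParity g * genParity h) •
        nop (gen h) (nop (gen g) (nop (gen k) (gen l))) :=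
  opProd_left_comm (parity_mul_parity n) (hasParity_gen g) (hasParity_gen h)
    (hasParity_nop_gen k l) (hasParity_contraction g k l) (hasParity_contraction h k l)
    (hasOPE_gen_gen g h) (hasOPE_gen_nop g k l) (hasOPE_gen_nop h k l)

theorem X_eq_gen (i : Fin n) : X i = gen (.inl (.X i)) := rfl

theorem Y_eq_gen (i : Fin n) : Y i = gen (.inl (.Y i)) := rfl

theorem psi_eq_gen (i : Fin n) : psi i = gen (.inr (.psi i)) := rfl

theorem chi_eq_gen (i : Fin n) : chi i = gen (.inr (.chi i)) := rfl

theorem nop_X_Y_nop_X_Y (i : Fin n) :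
    nop (nop (X i) (Y i)) (nop (X i) (Y i)) = nop (X i) (nop (Y i) (nop (X i) (Y i)))
      - nop (derivField (X i)) (Y i) + nop (derivField (Y i)) (X i) := by
  rw [X_eq_gen, Y_eq_gen, nop_nop_gen]
  simp only [contraction, pairing, bosonPairing, Boson.dual, Boson.sign, genParity, reduceIte,
    reduceCtorEq, mul_zero, mul_one, pow_zero, zero_smul, one_smul, add_zero, zero_add,
    nop_smul_right]
  module

theorem nop_chi_chi (i : Fin n) : nop (chi i) (chi i) = 0 := by
  have hcomm : nop (chi i) (chi i) = (-1 : ℂ) • nop (chi i) (chi i) := by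
    simpa only [chi_eq_gen, genParity, mul_one, pow_one] using
      nop_gen_comm (.inr (.chi i)) (.inr (.chi i))
  linear_combination (norm := module) (1 / 2 : ℂ) • hcomm

theorem nop_psi_chi_nop_psi_chi (i : Fin n) :
    nop (nop (psi i) (chi i)) (nop (psi i) (chi i)) =
      nop (derivField (psi i)) (chi i) + nop (derivField (chi i)) (psi i) := by
  rw [psi_eq_gen, chi_eq_gen, nop_nop_gen, nop_gen_left_comm (.inr (.chi i)), ← chi_eq_gen,
    nop_chi_chi, chi_eq_gen]
  simp only [contraction, pairing, fermionPairing, Fermion.dual, genParity, reduceIte,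
    reduceCtorEq, mul_zero, mul_one, pow_one, zero_smul, one_smul, smul_zero, add_zero, zero_add,
    nop_smul_right, nop_zero_right]
  module

theorem nop_Mplus_Mminus (i : Fin n) :
    nop (Mplus i) (Mminus i) = nop (X i) (nop (psi i) (nop (Y i) (chi i)))
      + nop (derivField (X i)) (Y i) + nop (derivField (psi i)) (chi i) := by
  rw [Mplus, Mminus, X_eq_gen, Y_eq_gen, psi_eq_gen, chi_eq_gen, nop_nop_gen]
  simp [contraction, genParity, pairing, bosonPairing, fermionPairing, Boson.dual, Boson.sign,
    Fermion.dual]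

theorem nop_Mminus_Mplus (i : Fin n) :
    nop (Mminus i) (Mplus i) = nop (Y i) (nop (chi i) (nop (X i) (psi i)))
      + nop (derivField (Y i)) (X i) - nop (derivField (chi i)) (psi i) := by
  rw [Mplus, Mminus, X_eq_gen, Y_eq_gen, psi_eq_gen, chi_eq_gen, nop_nop_gen]
  simp only [contraction, pairing, bosonPairing, fermionPairing, Boson.dual, Boson.sign,
    Fermion.dual, genParity, reduceIte, mul_zero, mul_one, pow_zero, zero_smul, one_smul,
    add_zero, zero_add, nop_smul_right]
  module

theorem nop_X_Y_nop_psi_chi (i : Fin n) :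
    nop (nop (X i) (Y i)) (nop (psi i) (chi i)) =
      nop (X i) (nop (psi i) (nop (Y i) (chi i))) := by
  rw [X_eq_gen, Y_eq_gen, psi_eq_gen, chi_eq_gen, nop_nop_gen,
    nop_gen_left_comm (.inl (.Y i)) (.inr (.psi i))]
  simp [contraction, genParity, pairing, nop_zero_right]

theorem nop_psi_chi_nop_X_Y (i : Fin n) :
    nop (nop (psi i) (chi i)) (nop (X i) (Y i)) =
      -nop (Y i) (nop (chi i) (nop (X i) (psi i))) := by
  have hfermions : nop (psi i) (chi i) = -nop (chi i) (psi i) := by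
    rw [psi_eq_gen, chi_eq_gen, nop_gen_comm]
    simp only [genParity, mul_one, pow_one]
    module
  have hbosons : nop (X i) (Y i) = nop (Y i) (X i) := by
    rw [X_eq_gen, Y_eq_gen, nop_gen_comm]
    simp [genParity]
  have hassoc : nop (nop (chi i) (psi i)) (nop (Y i) (X i)) =
      nop (chi i) (nop (psi i) (nop (Y i) (X i))) := by
    rw [X_eq_gen, Y_eq_gen, psi_eq_gen, chi_eq_gen, nop_nop_gen]
    simp [contraction, pairing, nop_zero_right]
  have hinner : nop (psi i) (nop (Y i) (X i)) = nop (Y i) (nop (X i) (psi i)) := by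
    rw [X_eq_gen, Y_eq_gen, psi_eq_gen, nop_gen_left_comm, nop_gen_comm (.inr (.psi i))]
    simp [genParity]
  have houter : nop (chi i) (nop (Y i) (nop (X i) (psi i))) =
      nop (Y i) (nop (chi i) (nop (X i) (psi i))) := by
    rw [X_eq_gen, Y_eq_gen, psi_eq_gen, chi_eq_gen, nop_gen_left_comm_nop]
    simp [genParity]
  rw [hfermions, nop_neg_left, hbosons, hassoc, hinner, houter]

theorem T_eq (i : Fin n) :
    T i = nop (nop (X i) (Y i)) (nop (X i) (Y i))
      - (1 / 2 : ℂ) • nop (X i) (nop (Y i) (nop (X i) (Y i))) := by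
  simp only [T, covD, partialD, hatA, gaugeA, nop_neg_left, nop_neg_right, neg_neg]
  module

theorem T_eq_nop_current_current_sub (i : Fin n) :
    T i = (1 / 2 : ℂ) • nop (current i) (current i)
      - (1 / 2 : ℂ) • (nop (Mplus i) (Mminus i) - nop (Mminus i) (Mplus i)) := by
  rw [T_eq, nop_Mplus_Mminus, nop_Mminus_Mplus, current, nop_add_left, nop_add_right, nop_add_right,
    nop_X_Y_nop_psi_chi, nop_psi_chi_nop_X_Y, nop_psi_chi_nop_psi_chi]
  linear_combination (norm := module) (1 / 2 : ℂ) • nop_X_Y_nop_X_Y i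

end Identity

end FreeFieldVOA

end

theorem mainTheorem7 (n : ℕ) (i : Fin n) :
    FreeFieldVOA.BRSTEquiv (FreeFieldVOA.T i)
      ((1 / 2 : ℂ) • FreeFieldVOA.nop (FreeFieldVOA.U n + FreeFieldVOA.UF n)
          (FreeFieldVOA.U n + FreeFieldVOA.UF n)
        - (1 / 2 : ℂ) • (FreeFieldVOA.nop (FreeFieldVOA.Mplus i) (FreeFieldVOA.Mminus i)
          - FreeFieldVOA.nop (FreeFieldVOA.Mminus i) (FreeFieldVOA.Mplus i))) := by
  rw [FreeFieldVOA.brstEquiv_iff, FreeFieldVOA.T_eq_nop_current_current_sub]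
  exact ((FreeFieldVOA.nop_U_add_UF_smodEq i).symm.smul _).sub .rfl
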